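/- Let $G$ be a finite group, acting from the right. Let $S$ be a closed oriented smooth surface of genus one and $\varphi\colon S\to S^1\times S^1$ a diffeomorphism. Let $\pi\colon P\to S$ be a smooth principal $G$-bundle, where $P$ carries the orientation lifted from $S$. Then the action of $G$ on $P$ extends to a compact oriented smooth $3$-manifold with boundary $P$: there are a compact oriented smooth $3$-manifold $M$ with a smooth orientation-preserving (not necessarily free) right action of $G$ and a $G$-equivariant, orientation-preserving diffeomorphism of $P$ onto $\partial M$, by which we regard $P$ as $\partial M$. In other words, every $G$-cobordism over a closed surface of genus one is extendable. Moreover, $M$ can be chosen such that every connected component of $M$ meets $P$ and is a solid torus, on which $G$ acts by rotations, in the following sense. For $p\in P$ let $M_p$ be the component of $M$ that contains $p$, let $c\colon[0,1]\to P$ be the lift with $c(0)=p$ of the loop in $S$ through $\pi(p)$ that runs once around the first factor of $S^1\times S^1$ (with respect to $\varphi$), and let $g\in G$ be the monodromy of this loop, that is, the element with $c(0)=c(1)\cdot g$. Then there is a diffeomorphism $F$ of $M_p$ onto $D\times S^1$, where $D\subset\mathbb C$ is the closed unit disc, such that 1. $g$ maps $M_p$ to itself and acts on $D\times S^1$ (through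 $F$) by $(z,w)\mapsto(e^{2\pi i/|g|}z,\,w)$, where $|g|$ is the order of $g$; so it rotates the disc about its centre by the angle $2\pi/|g|$; 2. every $h\in G$ with $M_p\cdot h=M_p$ acts on $D\times S^1$ (through $F$) by $(z,w)\mapsto(az,bw)$ for some $a,b\in S^1$ depending on $h$. In particular, if $P$ is connected, then $M$ is a solid torus. -/

import Mathlib

open Set Topology
open scoped Manifold ContDiff

/-- An orientation of a smooth `n`-manifold `M` (possibly with boundary): for every point `x` it says
whether the preferred chart at `x` is positively (`1`) or negatively (`-1`) oriented at `x`, in such a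
way that nearby choices agree up to the sign of the Jacobian of the change of charts. -/
structure ManifoldOrientation {n : ℕ} {H : Type*} [TopologicalSpace H]
    (I : ModelWithCorners ℝ (EuclideanSpace ℝ (Fin n)) H) (M : Type*) [TopologicalSpace M]
    [ChartedSpace H M] [IsManifold I 1 M] where
  sign : M → ℤˣ
  coherent : ∀ x : M, ∀ᶠ y in 𝓝 x,
    0 < (((sign x * sign y : ℤˣ) : ℤ) : ℝ) * (tangentCoordChange I y x y).det

/-- The frame `v` of the tangent space at `x` is positively oriented. (Mathlib identifies
`TangentSpace I x` with `ℝⁿ` through the preferred chart at `x`.) -/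
def ManifoldOrientation.PositiveFrame {n : ℕ} {H : Type*} [TopologicalSpace H]
    {I : ModelWithCorners ℝ (EuclideanSpace ℝ (Fin n)) H} {M : Type*} [TopologicalSpace M]
    [ChartedSpace H M] [IsManifold I 1 M] (o : ManifoldOrientation I M) (x : M)
    (v : Fin n → TangentSpace I x) : Prop :=
  0 < (((o.sign x : ℤˣ) : ℤ) : ℝ) *
    (Matrix.of fun i j : Fin n => WithLp.ofLp (p := 2) (V := Fin n → ℝ) (v i) j).det

/-- A map between oriented manifolds of the same dimension preserves the orientation: its
differential sends positive frames to positive frames. -/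
def PreservesOrientation {n : ℕ} {H H' : Type*} [TopologicalSpace H] [TopologicalSpace H']
    {I : ModelWithCorners ℝ (EuclideanSpace ℝ (Fin n)) H}
    {I' : ModelWithCorners ℝ (EuclideanSpace ℝ (Fin n)) H'}
    {M : Type*} [TopologicalSpace M] [ChartedSpace H M] [IsManifold I 1 M]
    {N : Type*} [TopologicalSpace N] [ChartedSpace H' N] [IsManifold I' 1 N]
    (oM : ManifoldOrientation I M) (oN : ManifoldOrientation I' N) (f : M → N) : Prop :=
  ∀ (x : M) (v : Fin n → TangentSpace I x), oM.PositiveFrame x v →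
    oN.PositiveFrame (f x) (fun i => mfderiv I I' f x (v i))

/-- `ι : P → M` is compatible with the boundary orientation of the oriented 3-manifold `M`, with
the convention "outward vector first". In the preferred chart at a boundary point, which has values
in the half space `{x | 0 ≤ x 0}`, the outward vectors are those with negative `0`-th coordinate. -/
def IsOrientedBoundaryMap {P : Type*} [TopologicalSpace P]
    [ChartedSpace (EuclideanSpace ℝ (Fin 2)) P] [IsManifold (𝓡 2) 1 P]
    {M : Type*} [TopologicalSpace M] [ChartedSpace (EuclideanHalfSpace 3) M]
    [IsManifold (𝓡∂ 3) 1 M]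
    (oP : ManifoldOrientation (𝓡 2) P) (oM : ManifoldOrientation (𝓡∂ 3) M) (ι : P → M) : Prop :=
  ∀ (p : P) (v : Fin 2 → TangentSpace (𝓡 2) p) (ν : TangentSpace (𝓡∂ 3) (ι p)),
    oP.PositiveFrame p v → WithLp.ofLp (p := 2) (V := Fin 3 → ℝ) ν 0 < 0 →
      oM.PositiveFrame (ι p) (Fin.cons ν fun i => mfderiv (𝓡 2) (𝓡∂ 3) ι p (v i))

/-- `π : P → S` is a smooth principal `G`-bundle over the surface `S`, for a (finite) discrete group
`G` acting on `P` from the right; `p · g` is `MulOpposite.op g • p`. -/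
structure IsPrincipalBundle (G : Type*) [Group G] [TopologicalSpace G]
    {P S : Type*} [TopologicalSpace P] [ChartedSpace (EuclideanSpace ℝ (Fin 2)) P]
    [TopologicalSpace S] [ChartedSpace (EuclideanSpace ℝ (Fin 2)) S]
    [MulAction Gᵐᵒᵖ P] (π : P → S) : Prop where
  smooth_proj : IsLocalDiffeomorph (𝓡 2) (𝓡 2) ∞ π
  smooth_action : ∀ g : G, ContMDiff (𝓡 2) (𝓡 2) ∞ fun p : P => MulOpposite.op g • p
  proj_action : ∀ (g : G) (p : P), π (MulOpposite.op g • p) = π p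
  free : ∀ (g : G) (p : P), MulOpposite.op g • p = p → g = 1
  transitive : ∀ p q : P, π p = π q → ∃ g : G, MulOpposite.op g • p = q
  locally_trivial : ∀ s : S, ∃ e : Bundle.Trivialization G π, s ∈ e.baseSet ∧
    ∀ p : P, π p ∈ e.baseSet → ∀ g : G, (e (MulOpposite.op g • p)).2 = (e p).2 * g

/-- The oriented `G`-surface `P` is the boundary, through `ι`, of the compact oriented 3-manifold
`M` with a smooth orientation preserving right action of `G` that extends the one on `P`. -/
structure IsExtension (G : Type*) [Group G] {P : Type*} [TopologicalSpace P]
    [ChartedSpace (EuclideanSpace ℝ (Fin 2)) P] [IsManifold (𝓡 2) ∞ P] [MulAction Gᵐᵒᵖ P]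
    {M : Type*} [TopologicalSpace M] [ChartedSpace (EuclideanHalfSpace 3) M]
    [IsManifold (𝓡∂ 3) ∞ M] [MulAction Gᵐᵒᵖ M]
    (oP : ManifoldOrientation (𝓡 2) P) (oM : ManifoldOrientation (𝓡∂ 3) M) (ι : P → M) : Prop where
  compact : CompactSpace M
  hausdorff : T2Space M
  smooth_action : ∀ g : G, ContMDiff (𝓡∂ 3) (𝓡∂ 3) ∞ fun x : M => MulOpposite.op g • x
  oriented_action : ∀ g : G, PreservesOrientation oM oM fun x : M => MulOpposite.op g • x
  smooth : ContMDiff (𝓡 2) (𝓡∂ 3) ∞ ι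
  injective : Function.Injective ι
  immersion : ∀ p : P, Function.Injective (mfderiv (𝓡 2) (𝓡∂ 3) ι p)
  range_eq : range ι = (𝓡∂ 3).boundary M
  oriented_boundary : IsOrientedBoundaryMap oP oM ι
  equivariant : ∀ (g : G) (p : P), ι (MulOpposite.op g • p) = MulOpposite.op g • ι p

/-- `F` restricts to a diffeomorphism of the (open and closed) subset `C` of the 3-manifold `M` onto
the solid torus `D × S¹`, where `D` is the closed unit disc of `ℂ`; the smooth structure of `D × S¹`
is the one of a domain in `ℂ × S¹`. -/
structure IsSolidTorusParam {M : Type*} [TopologicalSpace M]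
    [ChartedSpace (EuclideanHalfSpace 3) M] (C : Set M) (F : M → ℂ × Circle) : Prop where
  smooth : ContMDiff (𝓡∂ 3) (𝓘(ℝ, ℂ).prod (𝓡 1)) ∞ F
  injOn : InjOn F C
  immersion : ∀ x ∈ C, Function.Injective (mfderiv (𝓡∂ 3) (𝓘(ℝ, ℂ).prod (𝓡 1)) F x)
  image_eq : F '' C = Metric.closedBall (0 : ℂ) 1 ×ˢ (univ : Set Circle)

/-- `g` is the monodromy along the loop `γ`, read off at the point `p` over `γ 0`: the bundle
over `γ` is obtained from `[0,1] × G` by identifying `(0, h)` with `(1, g h)`, where `(t, h)` stands for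
`c t · h` and `c` is the lift of `γ` that starts at `p`. -/
def HasMonodromy {G : Type*} [Group G] {P S : Type*} [TopologicalSpace P] [MulAction Gᵐᵒᵖ P]
    (π : P → S) (γ : unitInterval → S) (p : P) (g : G) : Prop :=
  ∃ c : C(unitInterval, P), (∀ t, π (c t) = γ t) ∧ c 0 = p ∧ c 0 = MulOpposite.op g • c 1

/-- The loop through `s` that runs once around the first circle factor of the torus, with respect to
a diffeomorphism `φ` of `S` with `S¹ × S¹`. -/
noncomputable def firstLoop {S : Type*} [TopologicalSpace S]
    [ChartedSpace (EuclideanSpace ℝ (Fin 2)) S]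
    (φ : S ≃ₘ^∞⟮𝓡 2, (𝓡 1).prod (𝓡 1)⟯ (Circle × Circle)) (s : S) : unitInterval → S :=
  fun t => φ.symm ((φ s).1 * Circle.exp (2 * Real.pi * (t : ℝ)), (φ s).2)

/-! Composing `π` with `φ` gives a covering of the torus on which `G` acts simply transitively on
fibres. By unique lifting, the translations of the torus lift to an action of the plane on `P`
(`IsTorusBundle.flow`), and uniqueness makes this action commute with `G`. Together the two actions
are transitive, so there are finitely many plane orbits and all points have the same stabilizer, a
lattice `L` inside `ℤ × ℤ`. Each orbit is thus a copy of `ℝ² / L`, and every element of `G` carries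
orbits to orbits by a translation.

The lattice has a basis `(-n, 0)`, `(a, m)` (`exists_triangular_basis`), where `n` is the order of
the monodromy of the first loop. In the coordinates dual to this basis, `P` becomes a disjoint union
of standard tori `S¹ × S¹`, the group acts by permuting them and rotating both factors, and the
monodromy, which is translation by `(-1, 0)`, becomes the rotation of the first factor by `2π / n`
(`IsTorusBundle.exists_angular_coordinates`). Rotations of a circle extend to its disc, so filling
the first factor of each torus with a disc gives `M`, with the action given by the same formulas.

The rest is differential topology. The smooth structure on the solid tori comes from their embedding
in copies of `ℂ × ℂ`: `IsImmersedAtlas` reduces smoothness and immersion questions to ambient maps.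
Orientations are compared through angular derivatives, which trivialize all tangent spaces involved.
The change of angles from the base torus to the new coordinates has determinant `-1 / (n m)`, so `M`
receives the sign opposite to that of `S`. -/

/-! ### Smooth structures read off from an immersion into a normed space -/

section ImmersedAtlas

variable {E V H : Type*} [NormedAddCommGroup E] [NormedSpace ℝ E] [NormedAddCommGroup V]
  [NormedSpace ℝ V] [TopologicalSpace H]

/-- The map `j` into a normed space is an immersion of class `C^n` with respect to the charts of
`M`: it is smooth in every chart, and every chart is a smooth function of `j`. -/
structure IsImmersedAtlas (I : ModelWithCorners ℝ E H) (n : WithTop ℕ∞) {M : Type*}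
    [TopologicalSpace M] [ChartedSpace H M] (j : M → V) : Prop where
  contDiffOn_comp_symm : ∀ e ∈ atlas H M,
    ContDiffOn ℝ n (j ∘ e.symm ∘ I.symm) (I.symm ⁻¹' e.target ∩ range I)
  exists_contDiffAt : ∀ e ∈ atlas H M, ∃ q : V → E, ∀ x ∈ e.source,
    ContDiffAt ℝ n q (j x) ∧ q (j x) = I (e x)

namespace IsImmersedAtlas

variable {I : ModelWithCorners ℝ E H} {n : WithTop ℕ∞} {M : Type*} [TopologicalSpace M]
  [ChartedSpace H M] {j : M → V}

/-- A change of charts factors as an inverse chart followed by `j`, then by the ambient function `q`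
of the second chart. Since `q` is smooth at points of `V`, nothing special happens at the boundary.
-/
theorem isManifold (h : IsImmersedAtlas I n j) : IsManifold I n M := by
  refine isManifold_of_contDiffOn I n M fun e e' he he' => ?_
  obtain ⟨q, hq⟩ := h.exists_contDiffAt e' he'
  have key : ∀ y ∈ I.symm ⁻¹' (e.symm ≫ₕ e').source ∩ range I,
      e.symm (I.symm y) ∈ e'.source ∧ I.symm y ∈ e.target := by
    rintro y ⟨hy, -⟩
    simp only [mem_preimage, OpenPartialHomeomorph.trans_source, mem_inter_iff,
      OpenPartialHomeomorph.symm_source] at hy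
    exact ⟨hy.2, hy.1⟩
  have h1 : ContDiffOn ℝ n (q ∘ (j ∘ e.symm ∘ I.symm))
      (I.symm ⁻¹' (e.symm ≫ₕ e').source ∩ range I) := by
    intro y hy
    refine ContDiffAt.comp_contDiffWithinAt y (hq _ (key y hy).1).1 ?_
    exact ((h.contDiffOn_comp_symm e he) y ⟨(key y hy).2, hy.2⟩).mono
      fun z hz => ⟨(key z hz).2, hz.2⟩
  exact h1.congr fun y hy => ((hq _ (key y hy).1).2).symm

theorem contMDiff [IsManifold I n M] (h : IsImmersedAtlas I n j) (hj : Continuous j) :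
    ContMDiff I 𝓘(ℝ, V) n j := by
  intro x
  rw [contMDiffAt_iff]
  refine ⟨hj.continuousAt, ?_⟩
  have hx : I.symm (extChartAt I x x) ∈ (chartAt H x).target := by
    simp [extChartAt]
  have := h.contDiffOn_comp_symm (chartAt H x) (chart_mem_atlas H x) (extChartAt I x x)
    ⟨hx, by simp [extChartAt]⟩
  have h2 : ContDiffWithinAt ℝ n (j ∘ (chartAt H x).symm ∘ I.symm) (range I)
      (extChartAt I x x) := by
    refine this.mono_of_mem_nhdsWithin ?_
    rw [inter_comm]
    refine inter_mem_nhdsWithin _ (I.continuous_symm.continuousAt.preimage_mem_nhds ?_)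
    exact (chartAt H x).open_target.mem_nhds hx
  exact h2

theorem exists_eq_extChartAt (h : IsImmersedAtlas I n j) (x : M) :
    ∃ q : V → E, ContDiffAt ℝ n q (j x) ∧ ∀ y ∈ (chartAt H x).source,
      q (j y) = extChartAt I x y := by
  obtain ⟨q, hq⟩ := h.exists_contDiffAt (chartAt H x) (chart_mem_atlas H x)
  exact ⟨q, (hq x (mem_chart_source H x)).1, fun y hy => (hq y hy).2⟩

/-- Near each point the target chart is a smooth function of `j`, so smoothness may be tested after
`j`; continuity keeps nearby values inside one chart. -/
theorem contMDiff_of_comp [IsManifold I n M] (h : IsImmersedAtlas I n j)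
    {E' H' N : Type*} [NormedAddCommGroup E'] [NormedSpace ℝ E'] [TopologicalSpace H']
    {I' : ModelWithCorners ℝ E' H'} [TopologicalSpace N] [ChartedSpace H' N] [IsManifold I' n N]
    {f : N → M} (hf : Continuous f) (hjf : ContMDiff I' 𝓘(ℝ, V) n (j ∘ f)) :
    ContMDiff I' I n f := by
  intro x
  rw [contMDiffAt_iff_target]
  refine ⟨hf.continuousAt, ?_⟩
  obtain ⟨q, hq, hqe⟩ := h.exists_eq_extChartAt (f x)
  have h1 : ContMDiffAt I' 𝓘(ℝ, E) n (q ∘ (j ∘ f)) x :=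
    ContMDiffAt.comp x (I' := 𝓘(ℝ, V)) hq.contMDiffAt (hjf x)
  refine h1.congr_of_eventuallyEq ?_
  filter_upwards [hf.continuousAt.preimage_mem_nhds
    ((chartAt H (f x)).open_source.mem_nhds (mem_chart_source H (f x)))] with y hy
  exact (hqe _ hy).symm

/-- If the chart at `x` is the function `q` of `j`, then `q` inverts the differential of `j`. -/
theorem fderiv_mvfderiv [IsManifold I n M] (h : IsImmersedAtlas I n j) (hj : Continuous j)
    (hn : n ≠ 0) {x : M} {q : V → E} (hq : ContDiffAt ℝ n q (j x))
    (hqe : ∀ y ∈ (chartAt H x).source, q (j y) = extChartAt I x y) (v : TangentSpace I x) :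
    fderiv ℝ q (j x) (mvfderiv I j x v) = (show E from v) := by
  have hjx : MDifferentiableAt I 𝓘(ℝ, V) j x := (h.contMDiff hj).mdifferentiable hn x
  have h1 : HasMFDerivAt I 𝓘(ℝ, E) (q ∘ j) x
      ((fderiv ℝ q (j x)).comp (mfderiv I 𝓘(ℝ, V) j x)) :=
    HasMFDerivAt.comp x (hq.differentiableAt hn).hasFDerivAt.hasMFDerivAt hjx.hasMFDerivAt
  have h2 : (q ∘ j) =ᶠ[𝓝 x] extChartAt I x := by
    filter_upwards [(chartAt H x).open_source.mem_nhds (mem_chart_source H x)] with y hy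
    exact hqe y hy
  have h3 : HasFDerivWithinAt (writtenInExtChartAt I 𝓘(ℝ, E) x (extChartAt I x))
      ((fderiv ℝ q (j x)).comp (mvfderiv I j x) : E →L[ℝ] E) (range I) (extChartAt I x x) := (h1.congr_of_eventuallyEq h2.symm).2
  have h4 : writtenInExtChartAt I 𝓘(ℝ, E) x (extChartAt I x) =ᶠ[𝓝[range I] (extChartAt I x x)]
      id := by
    filter_upwards [extChartAt_target_mem_nhdsWithin x] with y hy
    exact (extChartAt I x).right_inv hy
  have h5 : HasFDerivWithinAt (writtenInExtChartAt I 𝓘(ℝ, E) x (extChartAt I x))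
      (ContinuousLinearMap.id ℝ E) (range I) (extChartAt I x x) :=
    (hasFDerivWithinAt_id _ _).congr_of_eventuallyEq h4
      ((extChartAt I x).right_inv (mem_extChartAt_target x))
  -- At a boundary point derivatives exist only within `range I`; unique differentiability there
  -- still identifies the two of them.
  have h0 : UniqueDiffWithinAt ℝ (range I) (extChartAt I x x) :=
    I.uniqueDiffOn _ (by simp [extChartAt])
  have h6 : ((fderiv ℝ q (j x)).comp (mvfderiv I j x) : E →L[ℝ] E) =
      ContinuousLinearMap.id ℝ E := h0.eq h3 h5
  exact congrArg (fun L : E →L[ℝ] E => L v) h6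

theorem mvfderiv_injective [IsManifold I n M] (h : IsImmersedAtlas I n j) (hj : Continuous j)
    (hn : n ≠ 0) (x : M) : Function.Injective (mvfderiv I j x) := by
  obtain ⟨q, hq, hqe⟩ := h.exists_eq_extChartAt x
  intro v w hvw
  have := h.fderiv_mvfderiv hj hn hq hqe v
  rw [hvw, h.fderiv_mvfderiv hj hn hq hqe w] at this
  exact this.symm

end IsImmersedAtlas

end ImmersedAtlas

/-! ### Orientations defined by trivializations of the tangent spaces -/

section Frames

variable {n : ℕ}

/-- The determinant of `n` vectors of `ℝⁿ`. -/
noncomputable def vecDet (v : Fin n → EuclideanSpace ℝ (Fin n)) : ℝ :=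
  (Matrix.of fun i j : Fin n => v i j).det

theorem vecDet_eq_basis_det (v : Fin n → EuclideanSpace ℝ (Fin n)) :
    vecDet v = (EuclideanSpace.basisFun (Fin n) ℝ).toBasis.det v := by
  rw [vecDet, Module.Basis.det_apply, ← Matrix.det_transpose]
  congr 1

theorem vecDet_map (L : EuclideanSpace ℝ (Fin n) →L[ℝ] EuclideanSpace ℝ (Fin n))
    (v : Fin n → EuclideanSpace ℝ (Fin n)) : vecDet (fun i => L (v i)) = L.det * vecDet v := by
  rw [vecDet_eq_basis_det, vecDet_eq_basis_det]
  exact Module.Basis.det_comp _ (L : EuclideanSpace ℝ (Fin n) →ₗ[ℝ] EuclideanSpace ℝ (Fin n)) v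

theorem ContinuousLinearMap.det_comp_eq_mul {E : Type*} [NormedAddCommGroup E] [NormedSpace ℝ E]
    (L L' : E →L[ℝ] E) : (L.comp L').det = L.det * L'.det :=
  LinearMap.det_comp _ _

theorem det_ne_zero_of_injective
    {L : EuclideanSpace ℝ (Fin n) →L[ℝ] EuclideanSpace ℝ (Fin n)} (hL : Function.Injective L) :
    L.det ≠ 0 := by
  intro h
  have := LinearMap.bot_lt_ker_of_det_eq_zero
    (f := (L : EuclideanSpace ℝ (Fin n) →ₗ[ℝ] EuclideanSpace ℝ (Fin n))) h
  rw [LinearMap.ker_eq_bot.2 hL] at this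
  exact lt_irrefl _ this

variable {H : Type*} [TopologicalSpace H] {I : ModelWithCorners ℝ (EuclideanSpace ℝ (Fin n)) H}
  {M : Type*} [TopologicalSpace M] [ChartedSpace H M]
  {V : Type*} [NormedAddCommGroup V] [NormedSpace ℝ V]

/-- The differential of `j`, followed by a linear map that depends on the point, in the preferred
chart at each point. -/
noncomputable def inducedFrame (I : ModelWithCorners ℝ (EuclideanSpace ℝ (Fin n)) H) (j : M → V)
    (A : M → V →L[ℝ] EuclideanSpace ℝ (Fin n)) (x : M) :
    EuclideanSpace ℝ (Fin n) →L[ℝ] EuclideanSpace ℝ (Fin n) :=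
  (A x).comp (mvfderiv I j x)

theorem inducedFrame_apply (j : M → V) (A : M → V →L[ℝ] EuclideanSpace ℝ (Fin n)) (x : M)
    (v : TangentSpace I x) : inducedFrame I j A x v = A x (mvfderiv I j x v) := rfl

variable [IsManifold I 1 M]

theorem ManifoldOrientation.positiveFrame_iff (o : ManifoldOrientation I M) (x : M)
    (v : Fin n → TangentSpace I x) :
    o.PositiveFrame x v ↔ 0 < (((o.sign x : ℤˣ) : ℤ) : ℝ) *
      vecDet (fun i => (show EuclideanSpace ℝ (Fin n) from v i)) := Iff.rfl

/-- The preferred chart jumps from point to point, so `inducedFrame` itself is not continuous.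
Written in the fixed chart at `x` it is, at the cost of one factor `tangentCoordChange`, and a
nonzero continuous determinant keeps its sign. -/
theorem eventually_inducedFrame_pos {j : M → V} (hj : ContMDiff I 𝓘(ℝ, V) 1 j)
    {A : M → V →L[ℝ] EuclideanSpace ℝ (Fin n)} (hA : Continuous A)
    (hdet : ∀ x, (inducedFrame I j A x).det ≠ 0) (x : M) :
    ∀ᶠ y in 𝓝 x, 0 < (inducedFrame I j A x).det * (inducedFrame I j A y).det *
      (tangentCoordChange I y x y).det := by
  have hc : ContinuousAt (fun y => (A y).comp
      (inTangentCoordinates I 𝓘(ℝ, V) id j (mfderiv I 𝓘(ℝ, V) j) x y)) x :=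
    hA.continuousAt.clm_comp
      (ContMDiffAt.mfderiv_const (m := 0) (hj x) le_rfl).continuousAt
  have hcoord : ∀ y ∈ (chartAt H x).source, (A y).comp
      (inTangentCoordinates I 𝓘(ℝ, V) id j (mfderiv I 𝓘(ℝ, V) j) x y) =
      (inducedFrame I j A y).comp (tangentCoordChange I x y y) := by
    intro y hy
    refine (congrArg (A y).comp (inTangentCoordinates_eq (I := I) (I' := 𝓘(ℝ, V)) id j
      (mfderiv I 𝓘(ℝ, V) j) (x₀ := x) (x := y) hy (mem_univ _))).trans ?_
    rw [tangentBundleCore_coordChange_model_space]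
    rfl
  have hc' : ContinuousAt (fun y => (inducedFrame I j A y).comp (tangentCoordChange I x y y)) x :=
    hc.congr (Filter.eventuallyEq_of_mem
      ((chartAt H x).open_source.mem_nhds (mem_chart_source H x)) hcoord)
  have hd : ContinuousAt (fun y => (inducedFrame I j A x).det *
      ((inducedFrame I j A y).comp (tangentCoordChange I x y y)).det) x :=
    continuousAt_const.mul (ContinuousLinearMap.continuous_det.continuousAt.comp hc')
  have hself : ((inducedFrame I j A x).comp (tangentCoordChange I x x x)) =
      inducedFrame I j A x := by
    ext1 v
    rw [ContinuousLinearMap.comp_apply, tangentCoordChange_self (mem_extChartAt_source x)]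
  have hpos := hd.eventually (lt_mem_nhds (a := 0) (by
    beta_reduce
    rw [hself]
    exact mul_self_pos.2 (hdet x)))
  filter_upwards [hpos, (chartAt H x).open_source.mem_nhds (mem_chart_source H x)] with y h1 hy
  have hinv : (tangentCoordChange I x y y).det * (tangentCoordChange I y x y).det = 1 := by
    have : (tangentCoordChange I x y y).comp (tangentCoordChange I y x y) =
        ContinuousLinearMap.id ℝ _ := by
      ext1 v
      rw [ContinuousLinearMap.comp_apply, tangentCoordChange_comp, tangentCoordChange_self]
      · rfl
      · exact mem_extChartAt_source y
      · simp [hy]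
    rw [← ContinuousLinearMap.det_comp_eq_mul, this]
    exact LinearMap.det_id
  rw [ContinuousLinearMap.det_comp_eq_mul] at h1
  -- Continuity gives the coordinate change from `x` to `y`, while an orientation uses its inverse;
  -- multiplying by this square exchanges them without affecting the sign.
  have h3 : 0 < (tangentCoordChange I y x y).det ^ 2 :=
    sq_pos_of_ne_zero fun h => by rw [h, mul_zero] at hinv; exact zero_ne_one hinv
  have := mul_pos h1 h3
  calc (0 : ℝ) < _ := this
    _ = (inducedFrame I j A x).det * (inducedFrame I j A y).det *
      (tangentCoordChange I y x y).det *
        ((tangentCoordChange I x y y).det * (tangentCoordChange I y x y).det) := by ring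
    _ = _ := by rw [hinv, mul_one]

theorem exists_unit_mul_pos {a : ℝ} (ha : a ≠ 0) : ∃ u : ℤˣ, 0 < (((u : ℤˣ) : ℤ) : ℝ) * a := by
  rcases ha.lt_or_gt with h | h
  · exact ⟨-1, by simpa using h⟩
  · exact ⟨1, by simpa using h⟩

theorem unit_mul_self_real (u : ℤˣ) : (((u : ℤˣ) : ℤ) : ℝ) * (((u : ℤˣ) : ℤ) : ℝ) = 1 := by
  rcases Int.units_eq_one_or u with rfl | rfl <;> simp

theorem pos_iff_pos_mul_of_mul_pos {a b : ℝ} (h : 0 < a * b) (c : ℝ) :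
    0 < a * c ↔ 0 < b * c := by
  rcases mul_pos_iff.1 h with ⟨ha, hb⟩ | ⟨ha, hb⟩
  · rw [mul_pos_iff_of_pos_left ha, mul_pos_iff_of_pos_left hb]
  · rw [← neg_mul_neg a, ← neg_mul_neg b, mul_pos_iff_of_pos_left (neg_pos.2 ha),
      mul_pos_iff_of_pos_left (neg_pos.2 hb)]

/-- The orientation for which the isomorphisms `inducedFrame I j A x` of the tangent spaces with
`ℝⁿ` have sign `ε`. -/
theorem exists_orientation_of_inducedFrame {j : M → V} (hj : ContMDiff I 𝓘(ℝ, V) 1 j)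
    {A : M → V →L[ℝ] EuclideanSpace ℝ (Fin n)} (hA : Continuous A)
    (hdet : ∀ x, (inducedFrame I j A x).det ≠ 0) (ε : ℤˣ) :
    ∃ o : ManifoldOrientation I M, ∀ (x : M) (v : Fin n → TangentSpace I x),
      o.PositiveFrame x v ↔
        0 < (((ε : ℤˣ) : ℤ) : ℝ) * vecDet fun i => inducedFrame I j A x (v i) := by
  choose s hs using fun x => exists_unit_mul_pos (mul_ne_zero
    (by simp : (((ε : ℤˣ) : ℤ) : ℝ) ≠ 0) (hdet x))
  refine ⟨⟨s, fun x => ?_⟩, fun x v => ?_⟩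
  · filter_upwards [eventually_inducedFrame_pos hj hA hdet x] with y hy
    have := mul_pos (mul_pos (hs x) (hs y)) hy
    push_cast
    have h1 : 0 < ((inducedFrame I j A x).det * (inducedFrame I j A y).det) ^ 2 :=
      sq_pos_of_ne_zero (mul_ne_zero (hdet x) (hdet y))
    refine (pos_iff_pos_of_mul_pos ?_).2 h1
    calc (0 : ℝ) < _ := this
      _ = ((((ε : ℤˣ) : ℤ) : ℝ) * (((ε : ℤˣ) : ℤ) : ℝ)) * (((s x : ℤ) : ℝ) * ((s y : ℤ) : ℝ) *
        (tangentCoordChange I y x y).det * ((inducedFrame I j A x).det *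
          (inducedFrame I j A y).det) ^ 2) := by ring
      _ = _ := by rw [unit_mul_self_real, one_mul]
  · have h1 : vecDet (fun i => inducedFrame I j A x (v i)) =
        (inducedFrame I j A x).det * vecDet (fun i => (show EuclideanSpace ℝ (Fin n) from v i)) :=
      vecDet_map _ _
    rw [ManifoldOrientation.positiveFrame_iff, h1, ← mul_assoc]
    exact pos_iff_pos_mul_of_mul_pos (hs x) _

/-- The given orientation and the one induced by the frames both satisfy the same local sign rule,
so their quotient is locally constant, hence constant by connectedness. -/
theorem ManifoldOrientation.exists_positiveFrame_iff [PreconnectedSpace M] [Nonempty M]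
    (o : ManifoldOrientation I M) {j : M → V} (hj : ContMDiff I 𝓘(ℝ, V) 1 j)
    {A : M → V →L[ℝ] EuclideanSpace ℝ (Fin n)} (hA : Continuous A)
    (hdet : ∀ x, (inducedFrame I j A x).det ≠ 0) :
    ∃ ε : ℤˣ, ∀ (x : M) (v : Fin n → TangentSpace I x),
      o.PositiveFrame x v ↔
        0 < (((ε : ℤˣ) : ℤ) : ℝ) * vecDet fun i => inducedFrame I j A x (v i) := by
  choose s hs using fun x => exists_unit_mul_pos (hdet x)
  have hconst : IsLocallyConstant fun x => o.sign x * s x := by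
    refine (IsLocallyConstant.iff_eventually_eq _).2 fun x => ?_
    filter_upwards [eventually_inducedFrame_pos hj hA hdet x, o.coherent x] with y h1 h2
    have h3 := mul_pos (mul_pos (hs x) (hs y)) (mul_pos h1 h2)
    have h4 : 0 < ((((o.sign x * s x) * (o.sign y * s y) : ℤˣ) : ℤ) : ℝ) := by
      refine (pos_iff_pos_of_mul_pos ?_).2 (sq_pos_of_ne_zero (a := (inducedFrame I j A x).det *
        (inducedFrame I j A y).det * (tangentCoordChange I y x y).det) ?_)
      · refine h3.trans_eq ?_
        push_cast
        ring
      · exact h1.ne'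
    rcases Int.units_eq_one_or (o.sign x * s x) with h5 | h5 <;>
    rcases Int.units_eq_one_or (o.sign y * s y) with h6 | h6 <;>
    rw [h5, h6] at h4 ⊢ <;> norm_num at h4
  obtain ⟨x₀⟩ := ‹Nonempty M›
  refine ⟨o.sign x₀ * s x₀, fun x v => ?_⟩
  have h1 : vecDet (fun i => inducedFrame I j A x (v i)) =
      (inducedFrame I j A x).det * vecDet (fun i => (show EuclideanSpace ℝ (Fin n) from v i)) :=
    vecDet_map _ _
  rw [ManifoldOrientation.positiveFrame_iff, h1, hconst.apply_eq_of_preconnectedSpace x₀ x,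
    ← mul_assoc]
  refine pos_iff_pos_mul_of_mul_pos ?_ _
  refine (hs x).trans_eq ?_
  push_cast
  linear_combination (-((s x : ℤ) : ℝ) * (inducedFrame I j A x).det) *
    unit_mul_self_real (o.sign x)

end Frames

/-! ### The solid tori as a smooth manifold with boundary -/

section SolidTori

/-- The disjoint union of `k` solid tori. -/
def SolidTori (k : ℕ) : Type := Metric.closedBall (0 : ℂ) 1 × Circle × Fin k

namespace SolidTori

variable {k : ℕ}

noncomputable instance : TopologicalSpace (SolidTori k) :=
  inferInstanceAs (TopologicalSpace (Metric.closedBall (0 : ℂ) 1 × Circle × Fin k))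

instance : T2Space (SolidTori k) :=
  inferInstanceAs (T2Space (Metric.closedBall (0 : ℂ) 1 × Circle × Fin k))

instance : CompactSpace (SolidTori k) :=
  haveI : CompactSpace (Metric.closedBall (0 : ℂ) 1) :=
    isCompact_iff_compactSpace.1 (isCompact_closedBall _ _)
  inferInstanceAs (CompactSpace (Metric.closedBall (0 : ℂ) 1 × Circle × Fin k))

/-- The point with coordinates `z`, `w` of the `i`-th solid torus. -/
def mk (z : Metric.closedBall (0 : ℂ) 1) (w : Circle) (i : Fin k) : SolidTori k := (z, w, i)

/-- The coordinate in the unit disc. -/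
def disc (x : SolidTori k) : ℂ := x.1

/-- The coordinate in the circle. -/
def circle (x : SolidTori k) : Circle := x.2.1

/-- The number of the solid torus that contains `x`. -/
def index (x : SolidTori k) : Fin k := x.2.2

@[simp] theorem disc_mk (z : Metric.closedBall (0 : ℂ) 1) (w : Circle) (i : Fin k) :
    (mk z w i).disc = z := rfl

@[simp] theorem circle_mk (z : Metric.closedBall (0 : ℂ) 1) (w : Circle) (i : Fin k) :
    (mk z w i).circle = w := rfl

@[simp] theorem index_mk (z : Metric.closedBall (0 : ℂ) 1) (w : Circle) (i : Fin k) :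
    (mk z w i).index = i := rfl

theorem ext {x y : SolidTori k} (h : x.disc = y.disc) (h' : x.circle = y.circle)
    (h'' : x.index = y.index) : x = y :=
  Prod.ext (Subtype.ext h) (Prod.ext h' h'')

theorem norm_disc_le (x : SolidTori k) : ‖x.disc‖ ≤ 1 := mem_closedBall_zero_iff.1 x.1.2

theorem continuous_disc : Continuous (disc : SolidTori k → ℂ) :=
  continuous_subtype_val.comp continuous_fst

theorem continuous_circle : Continuous (circle : SolidTori k → Circle) :=
  continuous_fst.comp continuous_snd

theorem continuous_index : Continuous (index : SolidTori k → Fin k) :=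
  continuous_snd.comp continuous_snd

theorem continuous_mk {X : Type*} [TopologicalSpace X] {f : X → Metric.closedBall (0 : ℂ) 1}
    {g : X → Circle} {h : X → Fin k} (hf : Continuous f) (hg : Continuous g)
    (hh : Continuous h) : Continuous fun x => mk (f x) (g x) (h x) :=
  hf.prodMk (hg.prodMk hh)

/-- The coordinates of a point, as a point of `ℂ × ℂ`. -/
def toProd (x : SolidTori k) : ℂ × ℂ := (x.disc, (x.circle : ℂ))

theorem continuous_toProd : Continuous (toProd : SolidTori k → ℂ × ℂ) :=
  continuous_disc.prodMk (continuous_subtype_val.comp continuous_circle)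

end SolidTori

/-- The radial retraction of the plane onto the unit disc. -/
noncomputable def discRetraction (z : ℂ) : Metric.closedBall (0 : ℂ) 1 :=
  ⟨z / ((max 1 ‖z‖ : ℝ) : ℂ), by
    have h : 0 < max 1 ‖z‖ := lt_max_of_lt_left one_pos
    rw [mem_closedBall_zero_iff, norm_div, Complex.norm_real, Real.norm_of_nonneg h.le,
      div_le_one h]
    exact le_max_right _ _⟩

theorem continuous_discRetraction : Continuous discRetraction := by
  refine Continuous.subtype_mk (continuous_id.div (Complex.continuous_ofReal.comp
    (continuous_const.max continuous_norm)) fun z => ?_) _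
  exact Complex.ofReal_ne_zero.2 (lt_max_of_lt_left one_pos).ne'

theorem discRetraction_coe {z : ℂ} (hz : ‖z‖ ≤ 1) : (discRetraction z : ℂ) = z := by
  simp [discRetraction, max_eq_left hz]

/-- `ℂ × ℝ` as the Euclidean space. -/
noncomputable def complexProdReal : ℂ × ℝ →L[ℝ] EuclideanSpace ℝ (Fin 3) :=
  ((EuclideanSpace.equiv (Fin 3) ℝ).symm : (Fin 3 → ℝ) →L[ℝ] EuclideanSpace ℝ (Fin 3)).comp
    (ContinuousLinearMap.pi ![Complex.reCLM.comp (ContinuousLinearMap.fst ℝ ℂ ℝ),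
      Complex.imCLM.comp (ContinuousLinearMap.fst ℝ ℂ ℝ), ContinuousLinearMap.snd ℝ ℂ ℝ])

@[simp] theorem complexProdReal_zero (p : ℂ × ℝ) : complexProdReal p 0 = p.1.re := rfl
@[simp] theorem complexProdReal_one (p : ℂ × ℝ) : complexProdReal p 1 = p.1.im := rfl
@[simp] theorem complexProdReal_two (p : ℂ × ℝ) : complexProdReal p 2 = p.2 := rfl

/-- A chart of the closed unit disc with values in the right half plane, given by inverse smooth
maps between open subsets of `ℂ`. -/
structure DiscChart where
  toFun : ℂ → ℂ
  invFun : ℂ → ℂ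
  source : Set ℂ
  target : Set ℂ
  isOpen_source : IsOpen source
  isOpen_target : IsOpen target
  contDiffOn_toFun : ContDiffOn ℝ ∞ toFun source
  contDiff_invFun : ContDiff ℝ ∞ invFun
  map_source : ∀ z ∈ source, ‖z‖ ≤ 1 → toFun z ∈ target ∧ 0 ≤ (toFun z).re
  map_target : ∀ x ∈ target, 0 ≤ x.re → invFun x ∈ source ∧ ‖invFun x‖ ≤ 1
  left_inv : ∀ z ∈ source, ‖z‖ ≤ 1 → invFun (toFun z) = z
  right_inv : ∀ x ∈ target, 0 ≤ x.re → toFun (invFun x) = x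

namespace DiscChart

/-- The chart of the open disc by a translation. -/
noncomputable def interior : DiscChart where
  -- The shift by `2` moves the open disc into real part greater than `1`, away from the edge of the
  -- half plane.
  toFun z := z + 2
  invFun x := x - 2
  source := Metric.ball 0 1
  target := Metric.ball 2 1
  isOpen_source := Metric.isOpen_ball
  isOpen_target := Metric.isOpen_ball
  contDiffOn_toFun := (contDiff_id.add contDiff_const).contDiffOn
  contDiff_invFun := contDiff_id.sub contDiff_const
  map_source z hz _ := by
    rw [mem_ball_zero_iff] at hz
    refine ⟨by simpa [dist_eq_norm] using hz, ?_⟩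
    have := (abs_le.1 (Complex.abs_re_le_norm z)).1
    simp
    linarith
  map_target x hx _ := by
    rw [mem_ball_iff_norm] at hx
    exact ⟨by simpa using hx, hx.le⟩
  left_inv z _ _ := by simp
  right_inv x _ _ := by simp

/-- The chart by the logarithm, near the point `c` of the unit circle. -/
noncomputable def boundary (c : Circle) : DiscChart where
  -- The real part is `-log ‖z‖`: it is nonnegative on the disc away from zero, vanishes exactly on
  -- the circle and decreases outwards.
  toFun z := -Complex.log (z / c)
  invFun x := c * Complex.exp (-x)
  source := {z | z / c ∈ Complex.slitPlane}
  target := {x | x.im ∈ Ioo (-Real.pi) Real.pi}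
  isOpen_source := Complex.isOpen_slitPlane.preimage (continuous_id.div_const _)
  isOpen_target := isOpen_Ioo.preimage Complex.continuous_im
  contDiffOn_toFun := fun z hz => (ContDiffAt.comp z (g := Complex.log)
    (f := fun z : ℂ => z / c) ((Complex.contDiffAt_log hz).restrict_scalars ℝ)
    (contDiff_id.div_const _).contDiffAt).neg.contDiffWithinAt
  contDiff_invFun := contDiff_const.mul (Complex.contDiff_exp.comp contDiff_neg)
  map_source z hz hz' := by
    have h1 := Complex.neg_pi_lt_arg (z / c)
    have h2 := (Complex.arg_le_pi (z / c)).lt_of_ne (Complex.slitPlane_arg_ne_pi hz)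
    refine ⟨⟨?_, ?_⟩, ?_⟩
    · simpa [Complex.log_im] using h2
    · simp only [Complex.neg_im, Complex.log_im]; linarith
    · simp only [Complex.neg_re, Complex.log_re, norm_div, Circle.norm_coe, div_one]
      linarith [Real.log_nonpos (norm_nonneg z) hz']
  map_target x hx hx' := by
    have h : (c : ℂ) * Complex.exp (-x) / c = Complex.exp (-x) := by
      rw [mul_div_cancel_left₀ _ c.coe_ne_zero]
    refine ⟨?_, ?_⟩
    · simp only [mem_ofPred_eq, h, Complex.mem_slitPlane_iff_arg]
      refine ⟨?_, Complex.exp_ne_zero _⟩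
      rw [Complex.arg_exp, Complex.neg_im, (toIocMod_eq_self _).2]
      · linarith [hx.1]
      · exact ⟨by linarith [hx.2], by linarith [hx.1]⟩
    · rw [norm_mul, Circle.norm_coe, one_mul, Complex.norm_exp, Real.exp_le_one_iff,
        Complex.neg_re]
      exact neg_nonpos.2 hx'
  left_inv z hz _ := by
    have := Complex.slitPlane_ne_zero hz
    simp only [neg_neg]
    rw [Complex.exp_log this, mul_div_cancel₀ _ c.coe_ne_zero]
  right_inv x hx hx' := by
    rw [mul_div_cancel_left₀ _ c.coe_ne_zero, Complex.log_exp, neg_neg]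
    · simpa using hx.2
    · simpa using (by linarith [hx.1] : -x.im ≤ Real.pi)

/-- The coordinates in the half space that belong to a chart of the disc and the argument on the
circle, as a function on `ℂ × ℂ`. -/
noncomputable def coord (d : DiscChart) (c : Circle) (p : ℂ × ℂ) : EuclideanSpace ℝ (Fin 3) :=
  complexProdReal (d.toFun p.1, (Complex.log (p.2 / c)).im)

theorem contDiffAt_coord (d : DiscChart) (c : Circle) {p : ℂ × ℂ} (hp : p.1 ∈ d.source)
    (hp' : p.2 / c ∈ Complex.slitPlane) : ContDiffAt ℝ ∞ (d.coord c) p := by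
  refine complexProdReal.contDiff.contDiffAt.comp p (ContDiffAt.prodMk ?_ ?_)
  · exact (d.contDiffOn_toFun.contDiffAt (d.isOpen_source.mem_nhds hp)).comp p contDiffAt_fst
  · refine ContDiffAt.comp p (g := Complex.imCLM) (f := fun p : ℂ × ℂ => Complex.log (p.2 / c))
      Complex.imCLM.contDiff.contDiffAt ?_
    exact ContDiffAt.comp p (g := Complex.log) (f := fun p : ℂ × ℂ => p.2 / c)
      ((Complex.contDiffAt_log hp').restrict_scalars ℝ) (contDiffAt_snd.div_const _)

/-- The inverse of `coord`, as a map into `ℂ × ℂ`. -/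
noncomputable def param (d : DiscChart) (c : Circle) (y : EuclideanSpace ℝ (Fin 3)) : ℂ × ℂ :=
  (d.invFun (y 0 + y 1 * Complex.I), c * Complex.exp (y 2 * Complex.I))

theorem contDiff_coordinate (i : Fin 3) :
    ContDiff ℝ ∞ fun y : EuclideanSpace ℝ (Fin 3) => (y i : ℂ) :=
  Complex.ofRealCLM.contDiff.comp (EuclideanSpace.proj i : EuclideanSpace ℝ (Fin 3) →L[ℝ] ℝ).contDiff

theorem contDiff_param (d : DiscChart) (c : Circle) : ContDiff ℝ ∞ (d.param c) :=
  (d.contDiff_invFun.comp ((contDiff_coordinate 0).add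
    ((contDiff_coordinate 1).mul contDiff_const))).prodMk
    (contDiff_const.mul (Complex.contDiff_exp.comp
      ((contDiff_coordinate 2).mul contDiff_const)))

/-- The points with coordinates in the domain of a chart. -/
def coordTarget (d : DiscChart) : Set (EuclideanSpace ℝ (Fin 3)) :=
  {y | (y 0 + y 1 * Complex.I : ℂ) ∈ d.target ∧ y 2 ∈ Ioo (-Real.pi) Real.pi}

theorem isOpen_coordTarget (d : DiscChart) : IsOpen d.coordTarget :=
  (d.isOpen_target.preimage ((contDiff_coordinate 0).add
    ((contDiff_coordinate 1).mul contDiff_const)).continuous).inter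
    (isOpen_Ioo.preimage (EuclideanSpace.proj 2 : EuclideanSpace ℝ (Fin 3) →L[ℝ] ℝ).continuous)

theorem coord_mem (d : DiscChart) {c : Circle} {z : ℂ} {w : Circle} (hz : ‖z‖ ≤ 1)
    (h : z ∈ d.source) (h' : (w / c : ℂ) ∈ Complex.slitPlane) :
    d.coord c (z, w) ∈ d.coordTarget ∧ 0 ≤ d.coord c (z, w) 0 ∧
      d.param c (d.coord c (z, w)) = (z, (w : ℂ)) := by
  obtain ⟨h1, h2⟩ := d.map_source z h hz
  have h3 := Complex.neg_pi_lt_arg (w / c)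
  have h4 := (Complex.arg_le_pi (w / c)).lt_of_ne (Complex.slitPlane_arg_ne_pi h')
  refine ⟨⟨?_, ?_⟩, h2, Prod.ext ?_ ?_⟩
  · simpa [coord, Complex.re_add_im] using h1
  · simpa [coord, Complex.log_im] using ⟨h3, h4⟩
  · simpa [coord, param, Complex.re_add_im] using d.left_inv z h hz
  · have h5 : Complex.log (w / c) = ((Complex.log (w / c)).im : ℂ) * Complex.I := by
      apply Complex.ext
      · simp only [Complex.log_re, norm_div, Circle.norm_coe]
        simp
      · simp
    simp only [coord, param, complexProdReal_two]
    rw [← h5, Complex.exp_log (Complex.slitPlane_ne_zero h'), mul_div_cancel₀ _ c.coe_ne_zero]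

theorem param_mem (d : DiscChart) (c : Circle) {y : EuclideanSpace ℝ (Fin 3)}
    (hy : y ∈ d.coordTarget) (h0 : 0 ≤ y 0) :
    (d.param c y).1 ∈ d.source ∧ ‖(d.param c y).1‖ ≤ 1 ∧
      (d.param c y).2 / c ∈ Complex.slitPlane ∧ d.coord c (d.param c y) = y := by
  obtain ⟨h1, h2⟩ := d.map_target _ hy.1 (by simpa using h0)
  have h3 : (c : ℂ) * Complex.exp (y 2 * Complex.I) / c = Complex.exp (y 2 * Complex.I) := by
    rw [mul_div_cancel_left₀ _ c.coe_ne_zero]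
  have h4 : Complex.log (Complex.exp (y 2 * Complex.I)) = y 2 * Complex.I := by
    rw [Complex.log_exp]
    · simpa using hy.2.1
    · simpa using hy.2.2.le
  refine ⟨h1, h2, ?_, ?_⟩
  · simp only [param, h3, Complex.mem_slitPlane_iff_arg]
    refine ⟨?_, Complex.exp_ne_zero _⟩
    rw [← Complex.log_im, h4]
    simpa using hy.2.2.ne
  · have h5 := d.right_inv _ hy.1 (by simpa using h0)
    ext i
    fin_cases i
    · simp [coord, param, h5]
    · simp [coord, param, h5]
    · simp only [coord, param, h3, h4]
      simp

end DiscChart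

namespace SolidTori

variable {k : ℕ}

theorem mem_range_halfSpace {y : EuclideanSpace ℝ (Fin 3)} : y ∈ range (𝓡∂ 3) ↔ 0 ≤ y 0 := by
  rw [range_modelWithCornersEuclideanHalfSpace]
  rfl

/-- The chart of the `i`-th solid torus around the points over `c`. -/
noncomputable def chart (d : DiscChart) (c : Circle) (i : Fin k) :
    OpenPartialHomeomorph (SolidTori k) (EuclideanHalfSpace 3) where
  toFun x := (𝓡∂ 3).symm (d.coord c x.toProd)
  -- The retraction only makes the formula total and continuous; on `target` the point already lies
  -- in the disc.
  invFun y := mk (discRetraction (d.param c y.1).1) (c * Circle.exp (y.1 2)) i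
  source := {x | x.disc ∈ d.source ∧ (x.circle / c : ℂ) ∈ Complex.slitPlane ∧ x.index = i}
  target := {y | y.1 ∈ d.coordTarget}
  map_source' x hx := by
    obtain ⟨h1, h2, -⟩ := d.coord_mem x.norm_disc_le hx.1 hx.2.1
    have h3 := (𝓡∂ 3).right_inv (mem_range_halfSpace.2 h2)
    change (𝓡∂ 3) ((𝓡∂ 3).symm (d.coord c x.toProd)) ∈ d.coordTarget
    rwa [toProd, h3]
  map_target' y hy := by
    obtain ⟨h1, h2, h3, -⟩ := d.param_mem c hy y.2
    refine ⟨?_, ?_, rfl⟩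
    · rwa [disc_mk, discRetraction_coe h2]
    · simpa [DiscChart.param] using h3
  left_inv' x hx := by
    obtain ⟨-, h2, h3⟩ := d.coord_mem x.norm_disc_le hx.1 hx.2.1
    have h4 : ((𝓡∂ 3).symm (d.coord c x.toProd)).1 = d.coord c x.toProd :=
      (𝓡∂ 3).right_inv (mem_range_halfSpace.2 h2)
    rw [h4, toProd, h3]
    refine SolidTori.ext ?_ ?_ hx.2.2.symm
    · rw [disc_mk, discRetraction_coe x.norm_disc_le]
    · exact Circle.ext (by simpa [DiscChart.param] using congrArg Prod.snd h3)
  right_inv' y hy := by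
    obtain ⟨-, h2, -, h4⟩ := d.param_mem c hy y.2
    rw [toProd, disc_mk, circle_mk, discRetraction_coe h2]
    have h5 : ((d.param c y.1).1, ((c * Circle.exp (y.1 2) : Circle) : ℂ)) =
        d.param c y.1 := by simp [DiscChart.param]
    rw [h5, h4]
    exact (𝓡∂ 3).left_inv y
  open_source := (d.isOpen_source.preimage continuous_disc).inter
    ((Complex.isOpen_slitPlane.preimage
      ((continuous_subtype_val.comp continuous_circle).div_const _)).inter
      ((isOpen_discrete {i}).preimage continuous_index))
  open_target := d.isOpen_coordTarget.preimage continuous_subtype_val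
  continuousOn_toFun := by
    refine (𝓡∂ 3).continuous_symm.comp_continuousOn fun x hx => ?_
    exact (ContinuousAt.comp (g := d.coord c) (d.contDiffAt_coord c hx.1 hx.2.1).continuousAt
      continuous_toProd.continuousAt).continuousWithinAt
  continuousOn_invFun := by
    refine (continuous_mk (continuous_discRetraction.comp (continuous_fst.comp
      ((d.contDiff_param c).continuous.comp continuous_subtype_val)))
      (continuous_const.mul (Circle.exp.continuous.comp
      ((EuclideanSpace.proj 2 : EuclideanSpace ℝ (Fin 3) →L[ℝ] ℝ).continuous.comp
        continuous_subtype_val))) continuous_const).continuousOn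

theorem mem_chart_source_iff {d : DiscChart} {c : Circle} {i : Fin k} {x : SolidTori k} :
    x ∈ (chart d c i).source ↔
      x.disc ∈ d.source ∧ (x.circle / c : ℂ) ∈ Complex.slitPlane ∧ x.index = i := Iff.rfl

theorem toProd_chart_symm (d : DiscChart) (c : Circle) (i : Fin k) {y : EuclideanHalfSpace 3}
    (hy : y ∈ (chart d c i).target) :
    ((chart d c i).symm y).toProd = d.param c y.1 := by
  obtain ⟨-, h2, -, -⟩ := d.param_mem c hy y.2
  change toProd (mk (discRetraction (d.param c y.1).1) (c * Circle.exp (y.1 2)) i) = _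
  rw [toProd, disc_mk, circle_mk, discRetraction_coe h2]
  simp [DiscChart.param]

theorem coord_toProd (d : DiscChart) (c : Circle) (i : Fin k) {x : SolidTori k}
    (hx : x ∈ (chart d c i).source) : d.coord c x.toProd = (chart d c i x).1 := by
  obtain ⟨-, h2, -⟩ := d.coord_mem x.norm_disc_le hx.1 hx.2.1
  exact ((𝓡∂ 3).right_inv (mem_range_halfSpace.2 h2)).symm

open Classical in
/-- The chart of the disc around a given point. -/
noncomputable def discChartAt (x : SolidTori k) : DiscChart :=
  if h : ‖x.disc‖ = 1 then DiscChart.boundary ⟨x.disc, mem_sphere_zero_iff_norm.2 h⟩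
  else DiscChart.interior

theorem discChartAt_of_norm_eq {x : SolidTori k} {c : Circle} (h : x.disc = c) :
    x.discChartAt = DiscChart.boundary c := by
  have h1 : ‖x.disc‖ = 1 := by rw [h, Circle.norm_coe]
  rw [discChartAt, dif_pos h1]
  congr 1
  exact Circle.ext h

theorem disc_mem_discChartAt_source (x : SolidTori k) : x.disc ∈ x.discChartAt.source := by
  by_cases h : ‖x.disc‖ = 1
  · let c : Circle := ⟨x.disc, mem_sphere_zero_iff_norm.2 h⟩
    rw [discChartAt_of_norm_eq (c := c) rfl]
    change x.disc / x.disc ∈ Complex.slitPlane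
    rw [div_self (norm_ne_zero_iff.1 (by rw [h]; exact one_ne_zero))]
    exact Complex.one_mem_slitPlane
  · rw [discChartAt, dif_neg h]
    exact mem_ball_zero_iff.2 (x.norm_disc_le.lt_of_ne h)

/-- Boundary points get the logarithmic chart based at themselves and interior points the
translation, so the preferred chart shows which points are on the boundary and which vectors point
outwards. -/
noncomputable instance : ChartedSpace (EuclideanHalfSpace 3) (SolidTori k) where
  atlas := {e | ∃ d c i, e = chart d c i}
  chartAt x := chart x.discChartAt x.circle x.index
  mem_chart_source x := mem_chart_source_iff.2 ⟨x.disc_mem_discChartAt_source, by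
    rw [div_self x.circle.coe_ne_zero]; exact Complex.one_mem_slitPlane, rfl⟩
  chart_mem_atlas x := ⟨_, _, _, rfl⟩

/-- The maps `param` and `coord` are smooth between ambient vector spaces and mutually inverse on
the charts, which spares comparing interior and boundary charts pair by pair. -/
theorem isImmersedAtlas_toProd :
    IsImmersedAtlas (𝓡∂ 3) ∞ (toProd : SolidTori k → ℂ × ℂ) where
  contDiffOn_comp_symm := by
    rintro _ ⟨d, c, i, rfl⟩
    refine (d.contDiff_param c).contDiffOn.congr fun y hy => ?_
    rw [Function.comp_apply, Function.comp_apply, toProd_chart_symm d c i hy.1]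
    exact congrArg _ ((𝓡∂ 3).right_inv hy.2)
  exists_contDiffAt := by
    rintro _ ⟨d, c, i, rfl⟩
    exact ⟨d.coord c, fun x hx => ⟨d.contDiffAt_coord c (mem_chart_source_iff.1 hx).1
      (mem_chart_source_iff.1 hx).2.1, coord_toProd d c i hx⟩⟩

instance : IsManifold (𝓡∂ 3) ∞ (SolidTori k) := isImmersedAtlas_toProd.isManifold

theorem contMDiff_toProd : ContMDiff (𝓡∂ 3) 𝓘(ℝ, ℂ × ℂ) ∞ (toProd : SolidTori k → ℂ × ℂ) :=
  isImmersedAtlas_toProd.contMDiff continuous_toProd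

theorem mvfderiv_toProd_injective (x : SolidTori k) :
    Function.Injective (mvfderiv (𝓡∂ 3) (toProd : SolidTori k → ℂ × ℂ) x) :=
  isImmersedAtlas_toProd.mvfderiv_injective continuous_toProd (by simp) x

theorem mem_boundary_iff (x : SolidTori k) : x ∈ (𝓡∂ 3).boundary (SolidTori k) ↔ ‖x.disc‖ = 1 := by
  have h0 : extChartAt (𝓡∂ 3) x x = x.discChartAt.coord x.circle x.toProd :=
    (coord_toProd _ _ _ (mem_chart_source (EuclideanHalfSpace 3) x)).symm
  change (𝓡∂ 3).IsBoundaryPoint x ↔ _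
  rw [ModelWithCorners.isBoundaryPoint_iff, frontier_range_modelWithCornersEuclideanHalfSpace, h0]
  change 0 = (x.discChartAt.toFun x.disc).re ↔ _
  by_cases h : ‖x.disc‖ = 1
  · let c : Circle := ⟨x.disc, mem_sphere_zero_iff_norm.2 h⟩
    rw [discChartAt_of_norm_eq (c := c) rfl]
    simp [DiscChart.boundary, c, h]
  · rw [discChartAt, dif_neg h]
    have := (abs_le.1 (Complex.abs_re_le_norm x.disc)).1
    have := x.norm_disc_le
    simp only [DiscChart.interior, Complex.add_re, Complex.re_ofNat, h, iff_false]
    linarith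

end SolidTori

end SolidTori

/-! ### Local branches of the argument -/

section LocalAngle

variable {X : Type*}

/-- The local branch at `x` of the argument of a function with values in the unit circle. -/
noncomputable def localAngle (f : X → ℂ) (x y : X) : ℝ := (Complex.log (f y / f x)).im

@[simp] theorem localAngle_self (f : X → ℂ) (x : X) : localAngle f x x = 0 := by
  by_cases h : f x = 0 <;> simp [localAngle, h]

/-- No closeness of `y` to `x` is needed, since `exp ∘ log` is the identity off zero; the branch cut
matters only for smoothness. -/
theorem eq_mul_exp_localAngle {f : X → ℂ} {x y : X} (hx : ‖f x‖ = 1) (hy : ‖f y‖ = 1) :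
    f y = f x * Complex.exp (localAngle f x y * Complex.I) := by
  have h0 : f x ≠ 0 := norm_ne_zero_iff.1 (by rw [hx]; exact one_ne_zero)
  have h0' : f y ≠ 0 := norm_ne_zero_iff.1 (by rw [hy]; exact one_ne_zero)
  have h5 : Complex.log (f y / f x) = ((Complex.log (f y / f x)).im : ℂ) * Complex.I := by
    apply Complex.ext
    · simp only [Complex.log_re, norm_div, hx, hy]
      simp
    · simp
  rw [localAngle, ← h5, Complex.exp_log (div_ne_zero h0' h0), mul_div_cancel₀ _ h0]

end LocalAngle

/-! ### Derivatives of circle-valued functions -/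

section AngularDerivative

variable {E H X : Type*} [NormedAddCommGroup E] [NormedSpace ℝ E] [TopologicalSpace H]
  {I : ModelWithCorners ℝ E H} [TopologicalSpace X] [ChartedSpace H X]

theorem mvfderiv_normedSpace_comp {V W : Type*} [NormedAddCommGroup V] [NormedSpace ℝ V]
    [NormedAddCommGroup W] [NormedSpace ℝ W] {g : V → W} {f : X → V} {x : X}
    (hg : DifferentiableAt ℝ g (f x)) (hf : MDifferentiableAt I 𝓘(ℝ, V) f x)
    (v : TangentSpace I x) :
    mvfderiv I (g ∘ f) x v = fderiv ℝ g (f x) (mvfderiv I f x v) := by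
  have h := HasMFDerivAt.comp x hg.hasFDerivAt.hasMFDerivAt hf.hasMFDerivAt
  exact congrArg (fun L : E →L[ℝ] W => L v) h.mfderiv

theorem mvfderiv_manifold_comp {E' H' Y V : Type*} [NormedAddCommGroup E'] [NormedSpace ℝ E']
    [TopologicalSpace H'] {I' : ModelWithCorners ℝ E' H'} [TopologicalSpace Y]
    [ChartedSpace H' Y] [NormedAddCommGroup V] [NormedSpace ℝ V] {g : Y → V} {f : X → Y} {x : X}
    (hg : MDifferentiableAt I' 𝓘(ℝ, V) g (f x)) (hf : MDifferentiableAt I I' f x)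
    (v : TangentSpace I x) :
    mvfderiv I (g ∘ f) x v = mvfderiv I' g (f x) (mfderiv I I' f x v) :=
  mfderiv_comp_apply x hg hf v

theorem mvfderiv_congr {V : Type*} [NormedAddCommGroup V] [NormedSpace ℝ V] {f g : X → V} {x : X}
    (h : f =ᶠ[𝓝 x] g) (v : TangentSpace I x) :
    mvfderiv I f x v = mvfderiv I g x v := by
  have := h.mfderiv_eq (I := I) (I' := 𝓘(ℝ, V))
  exact congrArg (fun L : E →L[ℝ] V => L v) this

theorem mvfderiv_prodMk {V W : Type*} [NormedAddCommGroup V] [NormedSpace ℝ V]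
    [NormedAddCommGroup W] [NormedSpace ℝ W] {f : X → V} {g : X → W} {x : X}
    (hf : MDifferentiableAt I 𝓘(ℝ, V) f x) (hg : MDifferentiableAt I 𝓘(ℝ, W) g x)
    (v : TangentSpace I x) :
    mvfderiv I (fun y => (f y, g y)) x v = (mvfderiv I f x v, mvfderiv I g x v) := by
  have h : MDifferentiableAt I 𝓘(ℝ, V × W) (fun y => (f y, g y)) x := hf.prodMk_space hg
  have h1 := mvfderiv_normedSpace_comp (g := Prod.fst) differentiableAt_fst h v
  have h2 := mvfderiv_normedSpace_comp (g := Prod.snd) differentiableAt_snd h v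
  rw [fderiv_fst] at h1
  rw [fderiv_snd] at h2
  exact Prod.ext h1.symm h2.symm

theorem contMDiffAt_localAngle {n : WithTop ℕ∞} {f : X → ℂ} {x y : X}
    (hf : ContMDiffAt I 𝓘(ℝ, ℂ) n f y) (hx : f y / f x ∈ Complex.slitPlane) :
    ContMDiffAt I 𝓘(ℝ, ℝ) n (localAngle f x) y := by
  have h : ContDiffAt ℝ n (fun z : ℂ => (Complex.log (z / f x)).im) (f y) :=
    ContDiffAt.comp (f y) (g := Complex.imCLM) (f := fun z : ℂ => Complex.log (z / f x))
      Complex.imCLM.contDiff.contDiffAt (ContDiffAt.comp (f y) (g := Complex.log)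
      (f := fun z : ℂ => z / f x) ((Complex.contDiffAt_log hx).restrict_scalars ℝ)
        (contDiffAt_id.div_const _))
  exact ContMDiffAt.comp y (I' := 𝓘(ℝ, ℂ)) (g := fun z : ℂ => (Complex.log (z / f x)).im) (f := f)
    h.contMDiffAt hf

/-- The derivative of a function with given argument and values in a circle. -/
theorem mvfderiv_mul_exp {f : X → ℂ} {g : X → ℝ} {c : ℂ} {x : X}
    (hg : MDifferentiableAt I 𝓘(ℝ, ℝ) g x)
    (hf : f =ᶠ[𝓝 x] fun y => c * Complex.exp (g y * Complex.I)) (v : TangentSpace I x) :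
    mvfderiv I f x v = mvfderiv I g x v * (Complex.I * f x) := by
  have h1 : HasFDerivAt (fun t : ℝ => c * Complex.exp (t * Complex.I))
      (ContinuousLinearMap.toSpanSingleton ℝ (Complex.I * f x)) (g x) := by
    have h2 : HasDerivAt (fun t : ℝ => c * Complex.exp (t * Complex.I))
        (Complex.I * f x) (g x) := by
      have h3 := (((hasDerivAt_id (g x)).ofReal_comp.mul_const Complex.I).cexp).const_mul c
      have h4 : c * (Complex.exp (g x * Complex.I) * (((1 : ℝ) : ℂ) * Complex.I)) =
          Complex.I * f x := by
        rw [hf.eq_of_nhds, Complex.ofReal_one]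
        ring
      exact h4 ▸ h3
    exact h2.hasFDerivAt
  rw [mvfderiv_congr hf]
  have h3 := mvfderiv_normedSpace_comp (g := fun t : ℝ => c * Complex.exp (t * Complex.I))
    h1.differentiableAt hg v
  rw [h1.fderiv] at h3
  refine h3.trans ?_
  simp

/-- The derivative of the argument of a point `w` of the unit circle. -/
noncomputable def angular (w : ℂ) : ℂ →L[ℝ] ℝ :=
  Complex.imCLM.comp (ContinuousLinearMap.mul ℝ ℂ (star w))

theorem angular_apply (w z : ℂ) : angular w z = (star w * z).im := rfl

theorem continuous_angular : Continuous angular :=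
  continuous_const.clm_comp ((ContinuousLinearMap.mul ℝ ℂ).continuous.comp continuous_star)

theorem angular_mul_I {w : ℂ} (hw : ‖w‖ = 1) (t : ℝ) : angular w (t * (Complex.I * w)) = t := by
  have h : star w * w = 1 := by
    have := Complex.conj_mul' w
    rw [hw] at this
    simpa using this
  have : star w * (t * (Complex.I * w)) = t * Complex.I := by linear_combination t * Complex.I * h
  rw [angular_apply, this]
  simp

theorem angular_mul_mul {c : ℂ} (hc : ‖c‖ = 1) (w z : ℂ) : angular (c * w) (c * z) = angular w z := by
  have h : star c * c = 1 := by
    have := Complex.conj_mul' c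
    rw [hc] at this
    simpa using this
  have : star (c * w) * (c * z) = star w * z := by
    rw [star_mul]
    linear_combination star w * z * h
  rw [angular_apply, angular_apply, this]

theorem angular_mvfderiv {f : X → ℂ} (hf1 : ∀ y, ‖f y‖ = 1) {g : X → ℝ} {c : ℂ} {x : X}
    (hg : MDifferentiableAt I 𝓘(ℝ, ℝ) g x)
    (hf : f =ᶠ[𝓝 x] fun y => c * Complex.exp (g y * Complex.I)) (v : TangentSpace I x) :
    angular (f x) (mvfderiv I f x v) = mvfderiv I g x v := by
  rw [mvfderiv_mul_exp hg hf, angular_mul_I (hf1 x)]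

/-- The derivative of the local argument. -/
theorem mvfderiv_localAngle {f : X → ℂ} (hf1 : ∀ y, ‖f y‖ = 1) {x : X}
    (hf : ContMDiffAt I 𝓘(ℝ, ℂ) 1 f x) (v : TangentSpace I x) :
    mvfderiv I (localAngle f x) x v = angular (f x) (mvfderiv I f x v) := by
  have h0 : f x ≠ 0 := norm_ne_zero_iff.1 (by rw [hf1]; exact one_ne_zero)
  refine (angular_mvfderiv hf1 (c := f x) ?_ (Filter.Eventually.of_forall fun y =>
    eq_mul_exp_localAngle (hf1 x) (hf1 y)) v).symm
  refine (contMDiffAt_localAngle hf ?_).mdifferentiableAt one_ne_zero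
  rw [div_self h0]
  exact Complex.one_mem_slitPlane

/-- The velocity is tangent to the circle, hence a real multiple of `I * f x`. The real number
`angular` therefore loses no information about the derivative. -/
theorem mvfderiv_eq_angular_mul {f : X → ℂ} (hf1 : ∀ y, ‖f y‖ = 1) {x : X}
    (hf : ContMDiffAt I 𝓘(ℝ, ℂ) 1 f x) (v : TangentSpace I x) :
    mvfderiv I f x v = angular (f x) (mvfderiv I f x v) * (Complex.I * f x) := by
  have h0 : f x ≠ 0 := norm_ne_zero_iff.1 (by rw [hf1]; exact one_ne_zero)
  rw [← mvfderiv_localAngle hf1 hf]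
  refine mvfderiv_mul_exp (c := f x) ?_ (Filter.Eventually.of_forall fun y =>
    eq_mul_exp_localAngle (hf1 x) (hf1 y)) v
  refine (contMDiffAt_localAngle hf ?_).mdifferentiableAt one_ne_zero
  rw [div_self h0]
  exact Complex.one_mem_slitPlane

end AngularDerivative

/-! ### Rotations, components and boundary orientation of the solid tori -/

section SolidToriMaps

theorem vecDet_fin_three (v : Fin 3 → EuclideanSpace ℝ (Fin 3)) :
    vecDet v = v 0 0 * v 1 1 * v 2 2 - v 0 0 * v 1 2 * v 2 1 - v 0 1 * v 1 0 * v 2 2 +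
      v 0 1 * v 1 2 * v 2 0 + v 0 2 * v 1 0 * v 2 1 - v 0 2 * v 1 1 * v 2 0 := by
  rw [vecDet, Matrix.det_fin_three]
  rfl

theorem vecDet_complexProdReal_mul (a : Circle) (z : Fin 3 → ℂ) (t : Fin 3 → ℝ) :
    vecDet (fun i => complexProdReal (a * z i, t i)) =
      vecDet fun i => complexProdReal (z i, t i) := by
  have h : (a : ℂ).re * (a : ℂ).re + (a : ℂ).im * (a : ℂ).im = 1 := by
    rw [← Complex.normSq_apply, Circle.normSq_coe]
  simp only [vecDet_fin_three, complexProdReal_zero, complexProdReal_one, complexProdReal_two,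
    Complex.mul_re, Complex.mul_im]
  -- The coefficient is the unrotated determinant: rotating the `ℂ` factor multiplies it by `‖a‖² =
  -- 1`.
  linear_combination ((z 0).re * (z 1).im * t 2 - (z 0).re * t 1 * (z 2).im -
    (z 0).im * (z 1).re * t 2 + (z 0).im * t 1 * (z 2).re + t 0 * (z 1).re * (z 2).im -
    t 0 * (z 1).im * (z 2).re) * h

namespace SolidTori

variable {k : ℕ}

theorem contMDiff_disc : ContMDiff (𝓡∂ 3) 𝓘(ℝ, ℂ) ∞ (disc : SolidTori k → ℂ) :=
  contDiff_fst.contMDiff.comp contMDiff_toProd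

theorem contMDiff_coe_circle :
    ContMDiff (𝓡∂ 3) 𝓘(ℝ, ℂ) ∞ fun x : SolidTori k => (x.circle : ℂ) :=
  contDiff_snd.contMDiff.comp contMDiff_toProd

theorem contMDiff_of_toProd {E' H' N : Type*} [NormedAddCommGroup E'] [NormedSpace ℝ E']
    [TopologicalSpace H'] {I' : ModelWithCorners ℝ E' H'} [TopologicalSpace N] [ChartedSpace H' N]
    [IsManifold I' ∞ N] {f : N → SolidTori k} (hf : Continuous f)
    (hjf : ContMDiff I' 𝓘(ℝ, ℂ × ℂ) ∞ (toProd ∘ f)) : ContMDiff I' (𝓡∂ 3) ∞ f :=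
  isImmersedAtlas_toProd.contMDiff_of_comp hf hjf

theorem mvfderiv_toProd (x : SolidTori k) (v : TangentSpace (𝓡∂ 3) x) :
    mvfderiv (𝓡∂ 3) toProd x v =
      (mvfderiv (𝓡∂ 3) disc x v, mvfderiv (𝓡∂ 3) (fun x => (x.circle : ℂ)) x v) :=
  mvfderiv_prodMk (contMDiff_disc.mdifferentiable (by simp) x)
    (contMDiff_coe_circle.mdifferentiable (by simp) x) v

/-- Identifies the tangent spaces of the solid tori, as subspaces of `ℂ × ℂ`, with `ℂ × ℝ`. -/
noncomputable def frameMap (x : SolidTori k) : ℂ × ℂ →L[ℝ] EuclideanSpace ℝ (Fin 3) :=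
  complexProdReal.comp ((ContinuousLinearMap.fst ℝ ℂ ℂ).prod
    ((angular x.circle).comp (ContinuousLinearMap.snd ℝ ℂ ℂ)))

theorem frameMap_apply (x : SolidTori k) (p : ℂ × ℂ) :
    x.frameMap p = complexProdReal (p.1, angular x.circle p.2) := rfl

theorem continuous_frameMap :
    Continuous (frameMap : SolidTori k → ℂ × ℂ →L[ℝ] EuclideanSpace ℝ (Fin 3)) := by
  refine continuous_const.clm_comp ?_
  have h : Continuous fun x : SolidTori k => (angular x.circle).comp
      (ContinuousLinearMap.snd ℝ ℂ ℂ) :=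
    (continuous_angular.comp (continuous_subtype_val.comp continuous_circle)).clm_comp
      continuous_const
  exact (ContinuousLinearMap.prodₗᵢ (𝕜 := ℝ) (E := ℂ × ℂ) (F := ℂ) (G := ℝ) ℝ).continuous.comp
    (continuous_const.prodMk h)

theorem mvfderiv_circle_eq (x : SolidTori k) (v : TangentSpace (𝓡∂ 3) x) :
    mvfderiv (𝓡∂ 3) (fun x : SolidTori k => (x.circle : ℂ)) x v =
      angular x.circle (mvfderiv (𝓡∂ 3) (fun x : SolidTori k => (x.circle : ℂ)) x v) *
        (Complex.I * x.circle) :=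
  mvfderiv_eq_angular_mul (fun y => Circle.norm_coe y.circle)
    ((contMDiff_coe_circle x).of_le (by norm_cast)) v

/-- The map `toProd` is an immersion, and the circle component of its derivative is recovered from
its angular part, so `frameMap` is injective on the tangent space. -/
theorem det_inducedFrame_ne_zero (x : SolidTori k) :
    (inducedFrame (𝓡∂ 3) toProd frameMap x).det ≠ 0 := by
  refine det_ne_zero_of_injective ((injective_iff_map_eq_zero _).2 ?_)
  suffices h : ∀ v : TangentSpace (𝓡∂ 3) x, x.frameMap (mvfderiv (𝓡∂ 3) toProd x v) = 0 → v = 0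
    from h
  intro v hv
  refine (injective_iff_map_eq_zero _).1 (mvfderiv_toProd_injective x) v ?_
  rw [mvfderiv_toProd] at hv ⊢
  rw [frameMap_apply] at hv
  have h0 := congrArg (fun y : EuclideanSpace ℝ (Fin 3) => y 0) hv
  have h1 := congrArg (fun y : EuclideanSpace ℝ (Fin 3) => y 1) hv
  have h2 := congrArg (fun y : EuclideanSpace ℝ (Fin 3) => y 2) hv
  simp only [complexProdReal_zero, complexProdReal_one, complexProdReal_two, PiLp.zero_apply]
    at h0 h1 h2
  refine Prod.ext (Complex.ext h0 h1) ?_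
  change mvfderiv (𝓡∂ 3) (fun x : SolidTori k => (x.circle : ℂ)) x v = 0
  rw [mvfderiv_circle_eq, h2]
  simp

/-- The solid tori have two orientations that agree up to sign with that of `ℂ × ℝ`. -/
theorem exists_orientation (ε : ℤˣ) : ∃ o : ManifoldOrientation (𝓡∂ 3) (SolidTori k),
    ∀ (x : SolidTori k) (v : Fin 3 → TangentSpace (𝓡∂ 3) x), o.PositiveFrame x v ↔
      0 < (((ε : ℤˣ) : ℤ) : ℝ) * vecDet fun i => x.frameMap (mvfderiv (𝓡∂ 3) toProd x (v i)) :=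
  exists_orientation_of_inducedFrame (contMDiff_toProd.of_le (by norm_cast))
    continuous_frameMap det_inducedFrame_ne_zero ε

/-- The map that rotates the `i`-th solid torus by `a i` and `b i` and puts it in the place of the
one with number `σ i`. -/
noncomputable def rotate (a b : Fin k → Circle) (σ : Fin k → Fin k) (x : SolidTori k) :
    SolidTori k :=
  mk ⟨a x.index * x.disc, by
    rw [mem_closedBall_zero_iff, norm_mul, Circle.norm_coe, one_mul]; exact x.norm_disc_le⟩
    (b x.index * x.circle) (σ x.index)

section Rotate

variable (a b : Fin k → Circle) (σ : Fin k → Fin k)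

@[simp] theorem disc_rotate (x : SolidTori k) :
    (rotate a b σ x).disc = a x.index * x.disc := rfl

@[simp] theorem circle_rotate (x : SolidTori k) :
    (rotate a b σ x).circle = b x.index * x.circle := rfl

@[simp] theorem index_rotate (x : SolidTori k) : (rotate a b σ x).index = σ x.index := rfl

theorem continuous_rotate : Continuous (rotate a b σ) := by
  have ha : Continuous fun x : SolidTori k => (a x.index : ℂ) :=
    (continuous_of_discreteTopology (f := fun i => (a i : ℂ))).comp continuous_index
  refine continuous_mk ((ha.mul continuous_disc).subtype_mk _)
    (((continuous_of_discreteTopology (f := b)).comp continuous_index).mul continuous_circle)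
    ((continuous_of_discreteTopology (f := σ)).comp continuous_index)

theorem eventually_index_eq (x : SolidTori k) : ∀ᶠ y in 𝓝 x, y.index = x.index :=
  continuous_index.continuousAt.eventually ((isOpen_discrete {x.index}).mem_nhds rfl)

/-- The rotation of `ℂ × ℂ` by two points of the unit circle. -/
noncomputable def _root_.rotationCLM (a b : Circle) : ℂ × ℂ →L[ℝ] ℂ × ℂ :=
  (ContinuousLinearMap.mul ℝ ℂ a).prodMap (ContinuousLinearMap.mul ℝ ℂ b)

theorem toProd_rotate_eventuallyEq (x : SolidTori k) :
    toProd ∘ rotate a b σ =ᶠ[𝓝 x] rotationCLM (a x.index) (b x.index) ∘ toProd := by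
  filter_upwards [eventually_index_eq x] with y hy
  simp [toProd, rotationCLM, hy]

theorem contMDiff_rotate : ContMDiff (𝓡∂ 3) (𝓡∂ 3) ∞ (rotate a b σ) := by
  refine contMDiff_of_toProd (continuous_rotate a b σ) fun x => ?_
  exact ((rotationCLM (a x.index) (b x.index)).contDiff.contMDiff.comp
    contMDiff_toProd).contMDiffAt.congr_of_eventuallyEq (toProd_rotate_eventuallyEq a b σ x)

theorem mvfderiv_rotate (x : SolidTori k) (v : TangentSpace (𝓡∂ 3) x) :
    mvfderiv (𝓡∂ 3) toProd (rotate a b σ x) (mfderiv (𝓡∂ 3) (𝓡∂ 3) (rotate a b σ) x v) =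
      rotationCLM (a x.index) (b x.index) (mvfderiv (𝓡∂ 3) toProd x v) := by
  rw [← mvfderiv_manifold_comp (contMDiff_toProd.mdifferentiable (by simp) _)
    ((contMDiff_rotate a b σ).mdifferentiable (by simp) _),
    mvfderiv_congr (toProd_rotate_eventuallyEq a b σ x), mvfderiv_normedSpace_comp
    (rotationCLM (a x.index) (b x.index)).differentiableAt
    (contMDiff_toProd.mdifferentiable (by simp) _), ContinuousLinearMap.fderiv]

/-- The determinant of a frame does not change at all: rotating the circle leaves `angular`
invariant, and rotating the disc has determinant one. -/
theorem preservesOrientation_rotate {ε : ℤˣ} {o : ManifoldOrientation (𝓡∂ 3) (SolidTori k)}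
    (ho : ∀ (x : SolidTori k) (v : Fin 3 → TangentSpace (𝓡∂ 3) x), o.PositiveFrame x v ↔
      0 < (((ε : ℤˣ) : ℤ) : ℝ) * vecDet fun i => x.frameMap (mvfderiv (𝓡∂ 3) toProd x (v i))) :
    PreservesOrientation o o (rotate a b σ) := by
  intro x v hv
  rw [ho] at hv ⊢
  refine hv.trans_eq (congrArg _ ?_)
  have h : ∀ i, (rotate a b σ x).frameMap (mvfderiv (𝓡∂ 3) toProd (rotate a b σ x)
      (mfderiv (𝓡∂ 3) (𝓡∂ 3) (rotate a b σ) x (v i))) =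
      complexProdReal (a x.index * (mvfderiv (𝓡∂ 3) toProd x (v i)).1,
        angular x.circle (mvfderiv (𝓡∂ 3) toProd x (v i)).2) := by
    intro i
    rw [mvfderiv_rotate, frameMap_apply, circle_rotate, Circle.coe_mul]
    exact congrArg (fun t => complexProdReal (_, t))
      (angular_mul_mul (Circle.norm_coe (b x.index)) _ _)
  simp_rw [h, vecDet_complexProdReal_mul]
  rfl

end Rotate

theorem connectedComponent_eq (x : SolidTori k) : connectedComponent x = {y | y.index = x.index} := by
  apply Subset.antisymm
  · intro y hy
    have h := continuous_index.image_connectedComponent_subset x (mem_image_of_mem _ hy)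
    rwa [connectedComponent_eq_singleton] at h
  · have : PreconnectedSpace (Metric.closedBall (0 : ℂ) 1) :=
      isPreconnected_iff_preconnectedSpace.1 (convex_closedBall _ _).isPreconnected
    have h : IsPreconnected (range fun p : Metric.closedBall (0 : ℂ) 1 × Circle =>
        mk p.1 p.2 x.index) :=
      isPreconnected_range (continuous_mk continuous_fst continuous_snd continuous_const)
    intro y hy
    refine h.subset_connectedComponent ⟨(x.1, x.circle), rfl⟩ ⟨(y.1, y.circle), ?_⟩
    exact SolidTori.ext rfl rfl (Eq.symm hy)

/-- The zeroth coordinate of the preferred chart is `-log ‖z‖`, whose differential at `c` is minus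
the radial component. Thus vectors that are outward in the chart are radially outward. -/
theorem boundary_frame_pos {x : SolidTori k} {c : Circle} (hc : x.disc = c)
    (ν : TangentSpace (𝓡∂ 3) x)
    (hν : WithLp.ofLp (p := 2) (V := Fin 3 → ℝ) ν 0 < 0) :
    0 < (star (c : ℂ) * mvfderiv (𝓡∂ 3) disc x ν).re := by
  have hd := discChartAt_of_norm_eq hc
  have hsrc := mem_chart_source_iff.1 (mem_chart_source (EuclideanHalfSpace 3) x)
  have h1 := isImmersedAtlas_toProd.fderiv_mvfderiv continuous_toProd (by simp)
    (x.discChartAt.contDiffAt_coord x.circle hsrc.1 hsrc.2.1)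
    (fun y hy => coord_toProd _ _ _ hy) ν
  have h2 : HasFDerivAt (fun p : ℂ × ℂ => x.discChartAt.coord x.circle p 0)
      ((EuclideanSpace.proj 0 : EuclideanSpace ℝ (Fin 3) →L[ℝ] ℝ).comp
        (fderiv ℝ (x.discChartAt.coord x.circle) x.toProd)) x.toProd :=
    HasFDerivAt.comp x.toProd (g := (EuclideanSpace.proj 0 : EuclideanSpace ℝ (Fin 3) →L[ℝ] ℝ))
      (ContinuousLinearMap.hasFDerivAt _)
      ((x.discChartAt.contDiffAt_coord x.circle hsrc.1 hsrc.2.1).differentiableAt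
        (by simp)).hasFDerivAt
  have h3 : HasFDerivAt (fun p : ℂ × ℂ => x.discChartAt.coord x.circle p 0)
      (-(Complex.reCLM.comp ((ContinuousLinearMap.mul ℝ ℂ (c : ℂ)⁻¹).comp
        (ContinuousLinearMap.fst ℝ ℂ ℂ)))) x.toProd := by
    have h4 : (fun p : ℂ × ℂ => x.discChartAt.coord x.circle p 0) =
        fun p => -(Complex.log ((c : ℂ)⁻¹ * p.1)).re := by
      ext p
      rw [hd]
      change (-Complex.log (p.1 / c)).re = _
      rw [Complex.neg_re, div_eq_inv_mul]
    have h5 : (c : ℂ)⁻¹ * x.toProd.1 = 1 := by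
      change (c : ℂ)⁻¹ * x.disc = 1
      rw [hc, inv_mul_cancel₀ c.coe_ne_zero]
    have h6 : HasFDerivAt Complex.log (ContinuousLinearMap.id ℝ ℂ) ((c : ℂ)⁻¹ * x.toProd.1) := by
      rw [h5]
      have h7 := (Complex.hasStrictDerivAt_log Complex.one_mem_slitPlane).hasDerivAt.hasFDerivAt
      refine (h7.restrictScalars ℝ).congr_fderiv ?_
      ext z; simp
    rw [h4]
    exact (Complex.reCLM.hasFDerivAt.comp x.toProd (h6.comp x.toProd
      (((ContinuousLinearMap.mul ℝ ℂ (c : ℂ)⁻¹).comp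
        (ContinuousLinearMap.fst ℝ ℂ ℂ)).hasFDerivAt (x := x.toProd)))).neg
  have h4 := congrArg (fun L : ℂ × ℂ →L[ℝ] ℝ => L (mvfderiv (𝓡∂ 3) toProd x ν)) (h2.unique h3)
  have h5 : (fderiv ℝ (x.discChartAt.coord x.circle) x.toProd (mvfderiv (𝓡∂ 3) toProd x ν)) 0 =
      -((c : ℂ)⁻¹ * (mvfderiv (𝓡∂ 3) toProd x ν).1).re := h4
  rw [h1, mvfderiv_toProd, ← Circle.coe_inv, Circle.coe_inv_eq_conj] at h5
  exact neg_lt_zero.1 (h5 ▸ hν)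

/-- A map whose image is in the boundary of the solid tori is compatible with the boundary
orientation if it is so with respect to the angular coordinates. -/
theorem isOrientedBoundaryMap {ε : ℤˣ} {oM : ManifoldOrientation (𝓡∂ 3) (SolidTori k)}
    (hoM : ∀ (x : SolidTori k) (v : Fin 3 → TangentSpace (𝓡∂ 3) x), oM.PositiveFrame x v ↔
      0 < (((ε : ℤˣ) : ℤ) : ℝ) * vecDet fun i => x.frameMap (mvfderiv (𝓡∂ 3) toProd x (v i)))
    {P : Type*} [TopologicalSpace P] [ChartedSpace (EuclideanSpace ℝ (Fin 2)) P]
    [IsManifold (𝓡 2) 1 P] (oP : ManifoldOrientation (𝓡 2) P) {ι : P → SolidTori k}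
    (hι : ContMDiff (𝓡 2) (𝓡∂ 3) ∞ ι) {u₁ u₂ : P → Circle} (h₁ : ∀ p, (ι p).disc = u₁ p)
    (h₂ : ∀ p, (ι p).circle = u₂ p)
    (hpos : ∀ (p : P) (v : Fin 2 → TangentSpace (𝓡 2) p), oP.PositiveFrame p v →
      0 < (((ε : ℤˣ) : ℤ) : ℝ) *
        (angular (u₁ p) (mvfderiv (𝓡 2) (fun q => (u₁ q : ℂ)) p (v 0)) *
          angular (u₂ p) (mvfderiv (𝓡 2) (fun q => (u₂ q : ℂ)) p (v 1)) -
        angular (u₂ p) (mvfderiv (𝓡 2) (fun q => (u₂ q : ℂ)) p (v 0)) *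
          angular (u₁ p) (mvfderiv (𝓡 2) (fun q => (u₁ q : ℂ)) p (v 1)))) :
    IsOrientedBoundaryMap oP oM ι := by
  intro p v ν hv hν
  have hd₁ : ContMDiff (𝓡 2) 𝓘(ℝ, ℂ) ∞ fun q => (u₁ q : ℂ) :=
    (contMDiff_disc.comp hι).congr fun q => (h₁ q).symm
  have hd₂ : ContMDiff (𝓡 2) 𝓘(ℝ, ℂ) ∞ fun q => (u₂ q : ℂ) :=
    (contMDiff_coe_circle.comp hι).congr fun q => congrArg _ (h₂ q).symm
  have hm : ∀ w : TangentSpace (𝓡 2) p,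
      mvfderiv (𝓡∂ 3) toProd (ι p) (mfderiv (𝓡 2) (𝓡∂ 3) ι p w) =
      (mvfderiv (𝓡 2) (fun q => (u₁ q : ℂ)) p w, mvfderiv (𝓡 2) (fun q => (u₂ q : ℂ)) p w) := by
    intro w
    have hcomp : toProd ∘ ι = fun q => ((u₁ q : ℂ), (u₂ q : ℂ)) := by
      ext q <;> simp [toProd, h₁, h₂]
    rw [← mvfderiv_manifold_comp (contMDiff_toProd.mdifferentiable (by simp) _)
      (hι.mdifferentiable (by simp) _), hcomp]
    exact mvfderiv_prodMk (hd₁.mdifferentiable (by simp) p) (hd₂.mdifferentiable (by simp) p) w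
  rw [hoM]
  have hν' := boundary_frame_pos (h₁ p) ν hν
  have hp := hpos p v hv
  set α := fun i => angular (u₁ p) (mvfderiv (𝓡 2) (fun q => (u₁ q : ℂ)) p (v i)) with hα
  set β := fun i => angular (u₂ p) (mvfderiv (𝓡 2) (fun q => (u₂ q : ℂ)) p (v i)) with hβ
  have hα' : ∀ i, mvfderiv (𝓡 2) (fun q => (u₁ q : ℂ)) p (v i) = α i * (Complex.I * u₁ p) :=
    fun i => mvfderiv_eq_angular_mul (fun q => Circle.norm_coe (u₁ q))
      ((hd₁ p).of_le (by norm_cast)) (v i)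
  -- After rotation by `(u₁ p)⁻¹` the two boundary vectors have purely imaginary disc components, so
  -- only the radial part of `ν` survives, times the minor of angular derivatives.
  have h : vecDet (fun i => (ι p).frameMap (mvfderiv (𝓡∂ 3) toProd (ι p)
      ((Fin.cons ν fun i => mfderiv (𝓡 2) (𝓡∂ 3) ι p (v i) :
        Fin 3 → TangentSpace (𝓡∂ 3) (ι p)) i))) =
      (star (u₁ p : ℂ) * mvfderiv (𝓡∂ 3) disc (ι p) ν).re * (α 0 * β 1 - β 0 * α 1) := by
    have h3 : (fun i => (ι p).frameMap (mvfderiv (𝓡∂ 3) toProd (ι p)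
        ((Fin.cons ν fun i => mfderiv (𝓡 2) (𝓡∂ 3) ι p (v i) :
          Fin 3 → TangentSpace (𝓡∂ 3) (ι p)) i))) = fun i => complexProdReal
        ((![mvfderiv (𝓡∂ 3) disc (ι p) ν, α 0 * (Complex.I * u₁ p), α 1 * (Complex.I * u₁ p)] :
          Fin 3 → ℂ) i, (![angular (ι p).circle (mvfderiv (𝓡∂ 3)
          (fun x : SolidTori k => (x.circle : ℂ)) (ι p) ν), β 0, β 1] : Fin 3 → ℝ) i) := by
      funext i
      refine Fin.cases ?_ (fun i => ?_) i
      · rw [Fin.cons_zero, mvfderiv_toProd, frameMap_apply]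
        rfl
      · rw [Fin.cons_succ, hm, frameMap_apply, hα', h₂]
        fin_cases i <;> rfl
    have h4 : ∀ t : ℝ, star (u₁ p : ℂ) * (t * (Complex.I * u₁ p)) = t * Complex.I := by
      intro t
      have h5 : star (u₁ p : ℂ) * u₁ p = 1 := by
        have := Complex.conj_mul' (u₁ p : ℂ)
        rw [Circle.norm_coe] at this
        simpa using this
      linear_combination t * Complex.I * h5
    have h5 : (((u₁ p)⁻¹ : Circle) : ℂ) = star (u₁ p : ℂ) := Circle.coe_inv_eq_conj _
    rw [h3, ← vecDet_complexProdReal_mul (u₁ p)⁻¹, vecDet_fin_three, h5]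
    simp only [complexProdReal_zero, complexProdReal_one, complexProdReal_two,
      Matrix.cons_val_zero, Matrix.cons_val_one, Matrix.cons_val, h4]
    simp only [Complex.mul_I_re, Complex.mul_I_im, Complex.ofReal_re, Complex.ofReal_im]
    ring
  rw [h, mul_left_comm]
  exact mul_pos hν' hp

end SolidTori

end SolidToriMaps

/-! ### Triangular bases of lattices -/

section Lattice

/-- A subgroup of finite index of `ℤ × ℤ` has a triangular basis. -/
theorem exists_triangular_basis (L : AddSubgroup (ℤ × ℤ)) {n₀ m₀ : ℤ} (hn₀ : n₀ ≠ 0)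
    (hm₀ : m₀ ≠ 0) (h₁ : (n₀, 0) ∈ L) (h₂ : (0, m₀) ∈ L) :
    ∃ (n m : ℕ) (a : ℤ), 0 < n ∧ 0 < m ∧ ((a, (m : ℤ)) ∈ L) ∧
      (∀ j : ℤ, (j, 0) ∈ L ↔ (n : ℤ) ∣ j) ∧
      ∀ x y : ℤ, (x, y) ∈ L → ∃ s t : ℤ, x = -n * s + a * t ∧ y = m * t := by
  -- The generator `n` belongs to the intersection with the first axis, and `m` to the projection
  -- onto the second.
  obtain ⟨n, hn⟩ := Int.subgroup_cyclic (L.comap (AddMonoidHom.inl ℤ ℤ))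
  obtain ⟨m, hm⟩ := Int.subgroup_cyclic (L.map (AddMonoidHom.snd ℤ ℤ))
  have hn' : ∀ j : ℤ, (j, 0) ∈ L ↔ (n.natAbs : ℤ) ∣ j := by
    intro j
    have : j ∈ L.comap (AddMonoidHom.inl ℤ ℤ) ↔ (j, 0) ∈ L := Iff.rfl
    rw [← this, hn, ← AddSubgroup.zmultiples_eq_closure, Int.mem_zmultiples_iff, Int.natAbs_dvd]
  have hm' : ∀ y : ℤ, (∃ x, (x, y) ∈ L) ↔ (m.natAbs : ℤ) ∣ y := by
    intro y
    have : y ∈ L.map (AddMonoidHom.snd ℤ ℤ) ↔ ∃ x, (x, y) ∈ L := by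
      simp [AddSubgroup.mem_map]
    rw [← this, hm, ← AddSubgroup.zmultiples_eq_closure, Int.mem_zmultiples_iff, Int.natAbs_dvd]
  obtain ⟨a, ha⟩ := (hm' m.natAbs).2 dvd_rfl
  refine ⟨n.natAbs, m.natAbs, a, ?_, ?_, ha, hn', fun x y hxy => ?_⟩
  · have := (hn' n₀).1 h₁
    exact Nat.pos_of_ne_zero fun h => hn₀ (by simpa [h] using this)
  · have := (hm' m₀).1 ⟨0, h₂⟩
    exact Nat.pos_of_ne_zero fun h => hm₀ (by simpa [h] using this)
  · obtain ⟨t, ht⟩ := (hm' y).1 ⟨x, hxy⟩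
    have h3 : (x - a * t, 0) ∈ L := by
      have := L.sub_mem hxy (L.zsmul_mem ha t)
      have h4 : (x, y) - t • (a, (m.natAbs : ℤ)) = (x - a * t, 0) := by
        rw [ht]
        ext <;> simp <;> ring
      rwa [h4] at this
    obtain ⟨s, hs⟩ := (hn' _).1 h3
    -- The first basis vector is taken as `(-n, 0)` because the monodromy translates backwards along
    -- the first axis.
    exact ⟨-s, t, by linarith, ht⟩

end Lattice

/-! ### The lifted action of the plane and its lattice of periods -/

section TorusBundle

/-- The universal covering of the torus. -/
noncomputable def torusExp (v : ℝ × ℝ) : Circle × Circle :=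
  (Circle.exp (2 * Real.pi * v.1), Circle.exp (2 * Real.pi * v.2))

theorem continuous_torusExp : Continuous torusExp := by
  unfold torusExp
  fun_prop

theorem torusExp_zero : torusExp 0 = 1 := by simp [torusExp]

theorem torusExp_add (v w : ℝ × ℝ) : torusExp (v + w) = torusExp v * torusExp w := by
  simp [torusExp, mul_add, Circle.exp_add]

theorem circle_exp_two_pi_mul_eq_one {t : ℝ} :
    Circle.exp (2 * Real.pi * t) = 1 ↔ ∃ j : ℤ, t = j := by
  rw [Circle.exp_eq_one]
  refine exists_congr fun j => ?_
  have := Real.pi_pos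
  constructor
  · intro h
    have h1 : 2 * Real.pi * (t - j) = 0 := by linarith
    rcases mul_eq_zero.1 h1 with h2 | h2
    · linarith
    · linarith
  · rintro rfl
    ring

theorem torusExp_eq_one {v : ℝ × ℝ} :
    torusExp v = 1 ↔ ∃ i j : ℤ, v = ((i : ℝ), (j : ℝ)) := by
  rw [torusExp, Prod.mk_eq_one, circle_exp_two_pi_mul_eq_one, circle_exp_two_pi_mul_eq_one]
  constructor
  · rintro ⟨⟨i, hi⟩, ⟨j, hj⟩⟩
    exact ⟨i, j, Prod.ext hi hj⟩
  · rintro ⟨i, j, rfl⟩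
    exact ⟨⟨i, rfl⟩, ⟨j, rfl⟩⟩

theorem torusExp_surjective : Function.Surjective torusExp := by
  rintro ⟨z, w⟩
  obtain ⟨s, rfl⟩ := Circle.exp_surjective z
  obtain ⟨t, rfl⟩ := Circle.exp_surjective w
  refine ⟨(s / (2 * Real.pi), t / (2 * Real.pi)), ?_⟩
  have := Real.pi_pos.ne'
  simp only [torusExp]
  congr 2 <;> field_simp

variable {G P : Type*} [Group G] [TopologicalSpace P] [MulAction Gᵐᵒᵖ P]

/-- A principal bundle over the torus, for a discrete group. -/
structure IsTorusBundle (G : Type*) {P : Type*} [Group G] [TopologicalSpace P]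
    [MulAction Gᵐᵒᵖ P] (f : P → Circle × Circle) : Prop where
  isCoveringMap : IsCoveringMap f
  continuous_smul : ∀ g : Gᵐᵒᵖ, Continuous fun p : P => g • p
  map_smul : ∀ (g : Gᵐᵒᵖ) (p : P), f (g • p) = f p
  free : ∀ (g : Gᵐᵒᵖ) (p : P), g • p = p → g = 1
  transitive : ∀ p q : P, f p = f q → ∃ g : Gᵐᵒᵖ, g • p = q

namespace IsTorusBundle

variable {f : P → Circle × Circle} (hf : IsTorusBundle G f)

include hf

/-- The plane is simply connected, so the translation orbit of `f p` lifts uniquely through the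
covering once the starting point is chosen. -/
theorem existsUnique_lift (p : P) :
    ∃! F : C(ℝ × ℝ, P), F 0 = p ∧ f ∘ F = fun v => f p * torusExp v :=
  hf.isCoveringMap.existsUnique_continuousMap_lifts
    ⟨fun v => f p * torusExp v, continuous_const.mul continuous_torusExp⟩ 0 p
    (by simp [torusExp_zero])

/-- The translations of the torus lift to an action of the plane on the total space. -/
noncomputable def flow (v : ℝ × ℝ) (p : P) : P := (hf.existsUnique_lift p).choose v

theorem continuous_flow (p : P) : Continuous fun v => hf.flow v p :=
  (hf.existsUnique_lift p).choose.continuous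

theorem flow_zero (p : P) : hf.flow 0 p = p := (hf.existsUnique_lift p).choose_spec.1.1

theorem map_flow (v : ℝ × ℝ) (p : P) : f (hf.flow v p) = f p * torusExp v :=
  congrFun (hf.existsUnique_lift p).choose_spec.1.2 v

theorem eq_flow {F : ℝ × ℝ → P} (hF : Continuous F) {p : P} (h0 : F 0 = p)
    (h : ∀ v, f (F v) = f p * torusExp v) (v : ℝ × ℝ) : F v = hf.flow v p :=
  congrArg (fun K : C(ℝ × ℝ, P) => K v)
    ((hf.existsUnique_lift p).choose_spec.2 ⟨F, hF⟩ ⟨h0, funext h⟩)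

/-- As functions of `v`, both sides lift the same map and agree at `0`. -/
theorem flow_add (v w : ℝ × ℝ) (p : P) : hf.flow (v + w) p = hf.flow v (hf.flow w p) := by
  refine hf.eq_flow (F := fun v => hf.flow (v + w) p)
    ((hf.continuous_flow p).comp (continuous_id.add continuous_const)) (by simp) (fun v => ?_) v
  rw [hf.map_flow, hf.map_flow, torusExp_add]
  ac_rfl

/-- The group acts over the identity of the torus, so it takes lifts to lifts; uniqueness does the
rest. -/
theorem flow_smul (v : ℝ × ℝ) (g : Gᵐᵒᵖ) (p : P) : hf.flow v (g • p) = g • hf.flow v p := by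
  refine (hf.eq_flow (F := fun v => g • hf.flow v p)
    ((hf.continuous_smul g).comp (hf.continuous_flow p)) ?_ (fun v => ?_) v).symm
  · simp only [flow_zero]
  · rw [hf.map_smul, hf.map_flow, hf.map_smul]

theorem flow_neg (v : ℝ × ℝ) (p : P) : hf.flow (-v) (hf.flow v p) = p := by
  rw [← flow_add, neg_add_cancel, flow_zero]

theorem exists_smul_flow_eq (p q : P) : ∃ (g : Gᵐᵒᵖ) (v : ℝ × ℝ), g • hf.flow v p = q := by
  obtain ⟨v, hv⟩ := torusExp_surjective ((f p)⁻¹ * f q)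
  obtain ⟨g, hg⟩ := hf.transitive (hf.flow v p) q (by rw [hf.map_flow, hv, mul_inv_cancel_left])
  exact ⟨g, v, hg⟩

/-- Translation by `v` commutes with both `G` and the plane, which together act transitively; so one
fixed point forces it to fix everything, and a single lattice serves all orbits. -/
theorem flow_eq_self_of_flow_eq_self {v : ℝ × ℝ} {p : P} (h : hf.flow v p = p) (q : P) :
    hf.flow v q = q := by
  obtain ⟨g, w, rfl⟩ := hf.exists_smul_flow_eq p q
  rw [flow_smul, ← flow_add, add_comm, flow_add, h]

/-- The translations of the plane that act trivially on the total space. -/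
def lattice : AddSubgroup (ℤ × ℤ) where
  carrier := {v | ∀ p : P, hf.flow ((v.1 : ℝ), (v.2 : ℝ)) p = p}
  zero_mem' p := by simpa [← Prod.zero_eq_mk] using hf.flow_zero p
  add_mem' {v w} hv hw p := by
    have : (((v + w).1 : ℝ), ((v + w).2 : ℝ)) =
        ((v.1 : ℝ), (v.2 : ℝ)) + ((w.1 : ℝ), (w.2 : ℝ)) := by ext <;> simp
    rw [this, flow_add, hw, hv]
  neg_mem' {v} hv p := by
    have : (((-v).1 : ℝ), ((-v).2 : ℝ)) = -((v.1 : ℝ), (v.2 : ℝ)) := by ext <;> simp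
    have h := hf.flow_neg ((v.1 : ℝ), (v.2 : ℝ)) p
    rwa [hv, ← this] at h

theorem mem_lattice {i j : ℤ} (p : P) :
    (i, j) ∈ hf.lattice ↔ hf.flow ((i : ℝ), (j : ℝ)) p = p :=
  ⟨fun h => h p, fun h q => hf.flow_eq_self_of_flow_eq_self h q⟩

theorem exists_mem_lattice_of_flow_eq {v w : ℝ × ℝ} {p : P} (h : hf.flow v p = hf.flow w p) :
    ∃ i j : ℤ, (i, j) ∈ hf.lattice ∧ v = ((i : ℝ), (j : ℝ)) + w := by
  have h1 : torusExp (v - w) = 1 := by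
    have h2 := hf.map_flow v p
    rw [h, hf.map_flow] at h2
    have h3 : torusExp v = torusExp (v - w) * torusExp w := by rw [← torusExp_add, sub_add_cancel]
    rw [h3, mul_right_inj] at h2
    exact right_eq_mul.1 h2
  obtain ⟨i, j, hij⟩ := torusExp_eq_one.1 h1
  refine ⟨i, j, (hf.mem_lattice (hf.flow w p)).2 ?_, by rw [← hij, sub_add_cancel]⟩
  rw [← hij, ← flow_add, sub_add_cancel, h]

theorem exists_monodromy (p : P) {v : ℝ × ℝ} (hv : torusExp v = 1) :
    ∃ g : G, MulOpposite.op g • hf.flow v p = p := by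
  obtain ⟨g, hg⟩ := hf.transitive (hf.flow v p) p (by rw [hf.map_flow, hv, mul_one])
  exact ⟨g.unop, hg⟩

theorem smul_eq_flow_neg {p : P} {g : Gᵐᵒᵖ} {v : ℝ × ℝ} (h : g • hf.flow v p = p) :
    g • p = hf.flow (-v) p := by
  conv_rhs => rw [← h]
  rw [flow_smul, flow_neg]

/-- Since `g` commutes with the flow, iterating it iterates the translation. With freeness this
turns the order of `g` into a question about the lattice. -/
theorem pow_smul_eq_flow {p : P} {g : Gᵐᵒᵖ} {v : ℝ × ℝ} (h : g • p = hf.flow v p) (j : ℕ) :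
    g ^ j • p = hf.flow ((j : ℝ) • v) p := by
  induction j with
  | zero => simp [flow_zero]
  | succ j ih =>
    rw [pow_succ, mul_smul, h, ← flow_smul, ih, ← flow_add]
    congr 1
    push_cast
    module

theorem pow_eq_one_iff {p : P} {g : Gᵐᵒᵖ} {v : ℝ × ℝ} (h : g • p = hf.flow v p) (j : ℕ) :
    g ^ j = 1 ↔ hf.flow ((j : ℝ) • v) p = p := by
  rw [← hf.pow_smul_eq_flow h]
  exact ⟨fun h => by rw [h, one_smul], hf.free _ _⟩

end IsTorusBundle

end TorusBundle

/-! ### Angular coordinates in which the group acts by rotations -/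

section AngularCoordinates

variable {G P : Type*} [Group G] [TopologicalSpace P] [MulAction Gᵐᵒᵖ P]

namespace IsTorusBundle

variable {f : P → Circle × Circle} (hf : IsTorusBundle G f)

/-- The orbits of the action of the plane. -/
def orbitSetoid : Setoid P where
  r p q := ∃ v, hf.flow v p = q
  iseqv := {
    refl := fun p => ⟨0, hf.flow_zero p⟩
    symm := by
      rintro p _ ⟨v, rfl⟩
      exact ⟨-v, hf.flow_neg v p⟩
    trans := by
      rintro p _ _ ⟨v, rfl⟩ ⟨w, rfl⟩
      exact ⟨w + v, hf.flow_add w v p⟩ }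

/-- The translates of one point by `G` meet every orbit of the plane. -/
theorem finite_quotient_orbitSetoid [Finite G] : Finite (Quotient hf.orbitSetoid) := by
  have : Finite Gᵐᵒᵖ := Finite.of_equiv G MulOpposite.opEquiv
  rcases isEmpty_or_nonempty P with h | ⟨⟨p⟩⟩
  · infer_instance
  · refine Finite.of_surjective (fun g : Gᵐᵒᵖ => (⟦g • p⟧ : Quotient hf.orbitSetoid)) fun x => ?_
    induction x using Quotient.inductionOn with
    | h q =>
      obtain ⟨g, v, rfl⟩ := hf.exists_smul_flow_eq p q
      exact ⟨g, Quotient.sound ⟨v, hf.flow_smul v g p⟩⟩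

include hf

/-- The monodromy of each coordinate loop has finite order, so a nonzero multiple of each standard
basis vector is a period. -/
theorem exists_lattice_basis [Finite G] [Nonempty P] :
    ∃ (n m : ℕ) (a : ℤ), 0 < n ∧ 0 < m ∧ ((a, (m : ℤ)) ∈ hf.lattice) ∧
      (∀ j : ℤ, (j, 0) ∈ hf.lattice ↔ (n : ℤ) ∣ j) ∧
      ∀ x y : ℤ, (x, y) ∈ hf.lattice → ∃ s t : ℤ, x = -n * s + a * t ∧ y = m * t := by
  have : Finite Gᵐᵒᵖ := Finite.of_equiv G MulOpposite.opEquiv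
  obtain ⟨p⟩ := ‹Nonempty P›
  have key : ∀ v : ℝ × ℝ, torusExp v = 1 → ∃ j : ℕ, j ≠ 0 ∧ hf.flow ((j : ℝ) • v) p = p := by
    intro v hv
    obtain ⟨g, hg⟩ := hf.transitive p (hf.flow v p) (by rw [hf.map_flow, hv, mul_one])
    exact ⟨orderOf g, (orderOf_pos g).ne', (hf.pow_eq_one_iff hg _).1 (pow_orderOf_eq_one g)⟩
  obtain ⟨n₀, hn₀, h₁⟩ := key (1, 0) (torusExp_eq_one.2 ⟨1, 0, by simp⟩)
  obtain ⟨m₀, hm₀, h₂⟩ := key (0, 1) (torusExp_eq_one.2 ⟨0, 1, by simp⟩)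
  refine exists_triangular_basis hf.lattice (n₀ := n₀) (m₀ := m₀) (by exact_mod_cast hn₀)
    (by exact_mod_cast hm₀) ((hf.mem_lattice p).2 ?_) ((hf.mem_lattice p).2 ?_)
  · simpa using h₁
  · simpa using h₂

/-- Near a point, the flow is a local inverse of the angular coordinates of the torus. -/
theorem eventually_flow_localAngle (p : P) : ∀ᶠ q in 𝓝 p,
    hf.flow (localAngle (fun q => ((f q).1 : ℂ)) p q / (2 * Real.pi),
      localAngle (fun q => ((f q).2 : ℂ)) p q / (2 * Real.pi)) p = q := by
  have hc := hf.isCoveringMap.continuous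
  have key : ∀ {g : P → Circle}, Continuous g →
      ContinuousAt (fun q => localAngle (fun q => (g q : ℂ)) p q / (2 * Real.pi)) p := by
    intro g hg
    have hg' : Continuous fun q => (g q : ℂ) := continuous_subtype_val.comp hg
    have h0 : (g p : ℂ) / g p ∈ Complex.slitPlane := by
      rw [div_self (g p).coe_ne_zero]
      exact Complex.one_mem_slitPlane
    have h1 : ContinuousAt (fun q => Complex.log ((g q : ℂ) / g p)) p :=
      (hg'.div_const _).continuousAt.clog h0
    exact (Complex.continuous_im.continuousAt.comp h1).div_const _
  have hexp : ∀ (g : P → Circle) (q : P), g p * Circle.exp (2 * Real.pi *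
      (localAngle (fun q => (g q : ℂ)) p q / (2 * Real.pi))) = g q := by
    intro g q
    rw [mul_div_cancel₀ _ (by positivity)]
    refine Circle.ext ?_
    rw [Circle.coe_mul, Circle.coe_exp]
    exact (eq_mul_exp_localAngle (f := fun q => (g q : ℂ)) (Circle.norm_coe _)
      (Circle.norm_coe _)).symm
  have hmap : ∀ q, f (hf.flow (localAngle (fun q => ((f q).1 : ℂ)) p q / (2 * Real.pi),
      localAngle (fun q => ((f q).2 : ℂ)) p q / (2 * Real.pi)) p) = f q := by
    intro q
    rw [hf.map_flow]
    exact Prod.ext (hexp (fun q => (f q).1) q) (hexp (fun q => (f q).2) q)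
  have hcont : ContinuousAt (fun q => hf.flow
      (localAngle (fun q => ((f q).1 : ℂ)) p q / (2 * Real.pi),
      localAngle (fun q => ((f q).2 : ℂ)) p q / (2 * Real.pi)) p) p :=
    (hf.continuous_flow p).continuousAt.comp
      ((key (continuous_fst.comp hc)).prodMk (key (continuous_snd.comp hc)))
  obtain ⟨U, hUo, hpU, hU⟩ := hf.isCoveringMap.isLocalHomeomorph.isLocallyInjective p
  have hflow0 : hf.flow (localAngle (fun q => ((f q).1 : ℂ)) p p / (2 * Real.pi),
      localAngle (fun q => ((f q).2 : ℂ)) p p / (2 * Real.pi)) p = p := by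
    simp only [localAngle_self, zero_div]
    exact hf.flow_zero p
  -- Both points lie over `f q` and near `p`, where `f` is injective.
  filter_upwards [hUo.mem_nhds hpU, hcont.preimage_mem_nhds
    (hUo.mem_nhds (by rw [hflow0]; exact hpU))] with q hq hq'
  exact hU hq' hq (hmap q)

/-- The total space of a principal bundle over the torus is a disjoint union of tori, with
coordinates in which the group acts by rotations and the monodromies of the first circle factor
only rotate the first coordinate. -/
theorem exists_angular_coordinates [Finite G] [Nonempty P] :
    ∃ (k n m : ℕ) (a : ℤ) (U : P → Circle × Circle) (idx : P → Fin k) (base : Fin k → P),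
      0 < n ∧ 0 < m ∧ (∀ i, U (base i) = 1 ∧ idx (base i) = i) ∧
      (∀ c i, ∃ q, U q = c ∧ idx q = i) ∧
      (∀ p q, U p = U q → idx p = idx q → p = q) ∧
      (∀ (h : Gᵐᵒᵖ) (q : P), U (h • q) = U (h • base (idx q)) * U q ∧
        idx (h • q) = idx (h • base (idx q))) ∧
      (∀ p : P, ∃ g : G, MulOpposite.op g • hf.flow (1, 0) p = p ∧ orderOf g = n ∧
        ∀ q, idx q = idx p →
          U (MulOpposite.op g • q) = (Circle.exp (2 * Real.pi / n), 1) * U q ∧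
          idx (MulOpposite.op g • q) = idx q) ∧
      ∀ p : P, ∀ᶠ q in 𝓝 p, idx q = idx p ∧
        (U q).1 = (U p).1 * Circle.exp ((a * localAngle (fun q => ((f q).2 : ℂ)) p q / m -
          localAngle (fun q => ((f q).1 : ℂ)) p q) / n) ∧
        (U q).2 = (U p).2 * Circle.exp (localAngle (fun q => ((f q).2 : ℂ)) p q / m) := by
  obtain ⟨n, m, a, hn, hm, ham, hnL, hL⟩ := hf.exists_lattice_basis
  have hn0 : (n : ℝ) ≠ 0 := by positivity
  have hm0 : (m : ℝ) ≠ 0 := by positivity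
  have := hf.finite_quotient_orbitSetoid
  obtain ⟨k, ⟨e⟩⟩ := Finite.exists_equiv_fin (Quotient hf.orbitSetoid)
  let idx : P → Fin k := fun p => e ⟦p⟧
  let base : Fin k → P := fun i => (e.symm i).out
  have hidx : ∀ {p q}, idx p = idx q ↔ ∃ v, hf.flow v p = q := fun {p q} =>
    e.injective.eq_iff.trans Quotient.eq
  have hbase : ∀ i, idx (base i) = i := fun i => by
    simp only [idx, base, Quotient.out_eq, Equiv.apply_symm_apply]
  have hidx_flow : ∀ v p, idx (hf.flow v p) = idx p := fun v p => (hidx.2 ⟨v, rfl⟩).symm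
  -- coordinates of the plane with respect to the basis of the lattice
  let N : ℝ × ℝ → ℝ × ℝ := fun v => ((a * v.2 / m - v.1) / n, v.2 / m)
  have hN_add : ∀ v w, N (v + w) = N v + N w := fun v w => by
    ext <;> simp only [N, Prod.fst_add, Prod.snd_add] <;> ring
  have hN_surj : ∀ x y : ℝ, N (-n * x + a * y, m * y) = (x, y) := fun x y => by
    ext <;> simp only [N] <;> field_simp
    ring
  have hN_inj : ∀ v, v = (-n * (N v).1 + a * (N v).2, m * (N v).2) := fun v => by
    ext <;> simp only [N] <;> field_simp
    ring
  -- In the coordinates `N` the lattice becomes `ℤ × ℤ`; this is the inclusion that makes `U`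
  -- independent of choices.
  have hN_lattice : ∀ i j : ℤ, (i, j) ∈ hf.lattice → torusExp (N ((i : ℝ), (j : ℝ))) = 1 := by
    intro i j hij
    obtain ⟨s, t, rfl, rfl⟩ := hL i j hij
    refine torusExp_eq_one.2 ⟨s, t, ?_⟩
    push_cast
    exact hN_surj s t
  -- The vector `w q` is determined only up to the lattice, which `torusExp ∘ N` does not see.
  choose w hw using fun q => hidx.1 (hbase (idx q))
  let U : P → Circle × Circle := fun q => torusExp (N (w q))
  have hU : ∀ v i, U (hf.flow v (base i)) = torusExp (N v) := by
    intro v i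
    have h1 := hw (hf.flow v (base i))
    rw [hidx_flow, hbase] at h1
    obtain ⟨x, y, hxy, h2⟩ := hf.exists_mem_lattice_of_flow_eq h1
    simp only [U]
    rw [h2, hN_add, torusExp_add, hN_lattice x y hxy, one_mul]
  have hU_flow : ∀ v q, U (hf.flow v q) = torusExp (N v) * U q := by
    intro v q
    conv_lhs => rw [← hw q, ← hf.flow_add, hU, hN_add, torusExp_add]
  have hU_base : ∀ i, U (base i) = 1 := fun i => by
    have := hU 0 i
    rw [hf.flow_zero] at this
    rw [this]
    simp [N, torusExp]
  refine ⟨k, n, m, a, U, idx, base, hn, hm, fun i => ⟨hU_base i, hbase i⟩, ?_, ?_, ?_, ?_, ?_⟩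
  · intro c i
    obtain ⟨⟨x, y⟩, rfl⟩ := torusExp_surjective c
    exact ⟨hf.flow (-n * x + a * y, m * y) (base i), by rw [hU, hN_surj],
      by rw [hidx_flow, hbase]⟩
  · intro p q hpq hi
    obtain ⟨v, rfl⟩ := hidx.1 hi
    rw [hU_flow, right_eq_mul] at hpq
    obtain ⟨s, t, hst⟩ := torusExp_eq_one.1 hpq
    have hv := hN_inj v
    rw [hst] at hv
    -- Conversely, integral coordinates come from lattice vectors; this gives injectivity.
    have h1 : (-(n : ℤ) * s + a * t, m * t) ∈ hf.lattice := by
      have h2 := hf.lattice.add_mem ((hnL (-(n : ℤ) * s)).2 ⟨-s, by ring⟩)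
        (hf.lattice.zsmul_mem ham t)
      convert h2 using 1
      ext <;> simp <;> ring
    have h3 := (hf.mem_lattice p).1 h1
    push_cast at h3
    rw [hv]
    exact h3.symm
  · intro h q
    have h1 : h • q = hf.flow (w q) (h • base (idx q)) := by rw [hf.flow_smul, hw]
    constructor
    · rw [h1, hU_flow, mul_comm]
    · rw [h1, hidx_flow]
  · intro p
    obtain ⟨g, hg⟩ := hf.exists_monodromy p (v := (1, 0)) (torusExp_eq_one.2 ⟨1, 0, by simp⟩)
    have hg' := hf.smul_eq_flow_neg hg
    refine ⟨g, hg, ?_, fun q hq => ?_⟩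
    -- As `g` translates by `(-1, 0)`, the equation `g ^ j = 1` says that `(-j, 0)` is a period.
    · have h1 : ∀ j : ℕ, g ^ j = 1 ↔ n ∣ j := by
        intro j
        rw [← MulOpposite.op_inj, MulOpposite.op_pow, MulOpposite.op_one, hf.pow_eq_one_iff hg',
          ← Int.natCast_dvd_natCast, ← dvd_neg, ← hnL, hf.mem_lattice p]
        simp
      exact Nat.dvd_antisymm (orderOf_dvd_of_pow_eq_one ((h1 n).2 dvd_rfl))
        ((h1 _).1 (pow_orderOf_eq_one g))
    · obtain ⟨v, rfl⟩ := hidx.1 hq.symm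
      have h1 : MulOpposite.op g • hf.flow v p = hf.flow (-(1, 0)) (hf.flow v p) := by
        rw [← hf.flow_smul, hg', ← hf.flow_add, ← hf.flow_add, add_comm]
      refine ⟨?_, by rw [h1, hidx_flow]⟩
      -- The translation by `(-1, 0)` has `N`-coordinates `(1 / n, 0)`: the sign chosen in `N` makes
      -- the rotation angle `+2π / n`.
      rw [h1, hU_flow]
      congr 1
      simp [N, torusExp, div_eq_mul_inv]
  · intro p
    filter_upwards [hf.eventually_flow_localAngle p] with q hq
    have h1 := hU_flow (localAngle (fun q => ((f q).1 : ℂ)) p q / (2 * Real.pi),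
      localAngle (fun q => ((f q).2 : ℂ)) p q / (2 * Real.pi)) p
    have h2 := hidx_flow (localAngle (fun q => ((f q).1 : ℂ)) p q / (2 * Real.pi),
      localAngle (fun q => ((f q).2 : ℂ)) p q / (2 * Real.pi)) p
    rw [hq] at h1 h2
    refine ⟨h2, ?_, ?_⟩
    · rw [h1, Prod.fst_mul, mul_comm]
      refine congrArg (fun t => (U p).1 * Circle.exp t) ?_
      simp only [N]
      field_simp
    · rw [h1, Prod.snd_mul, mul_comm]
      refine congrArg (fun t => (U p).2 * Circle.exp t) ?_
      simp only [N]
      field_simp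

end IsTorusBundle

end AngularCoordinates

/-! ### The circle as a manifold and the parametrization of each component by `D × S¹` -/

section CircleSmooth

attribute [local instance] finrank_real_complex_fact'

theorem contMDiff_circle_coe {n : WithTop ℕ∞} :
    ContMDiff (𝓡 1) 𝓘(ℝ, ℂ) n (fun c : Circle => (c : ℂ)) := contMDiff_coe_sphere

theorem mvfderiv_coe_circle_injective (c : Circle) :
    Function.Injective (mvfderiv (𝓡 1) (fun c : Circle => (c : ℂ)) c) :=
  injective_mvfderiv_subtypeVal_sphere (E := ℂ) c

theorem SolidTori.contMDiff_circle {k : ℕ} :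
    ContMDiff (𝓡∂ 3) (𝓡 1) ∞ (SolidTori.circle : SolidTori k → Circle) :=
  SolidTori.contMDiff_coe_circle.codRestrict_sphere (n := 1) (E := ℂ)
    fun x => mem_sphere_zero_iff_norm.2 (Circle.norm_coe x.circle)

end CircleSmooth

namespace SolidTori

variable {k : ℕ}

/-- The coordinates of a point, as a point of `ℂ × S¹`. -/
def toProdCircle (x : SolidTori k) : ℂ × Circle := (x.disc, x.circle)

theorem contMDiff_toProdCircle :
    ContMDiff (𝓡∂ 3) (𝓘(ℝ, ℂ).prod (𝓡 1)) ∞ (toProdCircle : SolidTori k → ℂ × Circle) :=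
  contMDiff_disc.prodMk contMDiff_circle

theorem mfderiv_toProdCircle_injective (x : SolidTori k) :
    Function.Injective (mfderiv (𝓡∂ 3) (𝓘(ℝ, ℂ).prod (𝓡 1)) toProdCircle x) := by
  have hg : ContMDiff (𝓘(ℝ, ℂ).prod (𝓡 1)) 𝓘(ℝ, ℂ × ℂ) ∞
      fun p : ℂ × Circle => (p.1, (p.2 : ℂ)) :=
    contMDiff_fst.prodMk_space (contMDiff_circle_coe.comp contMDiff_snd)
  intro v w hvw
  refine mvfderiv_toProd_injective x ?_
  have h := mvfderiv_manifold_comp (f := (toProdCircle : SolidTori k → ℂ × Circle)) (x := x)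
    (hg.mdifferentiable (by simp) _) (contMDiff_toProdCircle.mdifferentiable (by simp) _)
  exact (h v).trans ((congrArg _ hvw).trans (h w).symm)

theorem isSolidTorusParam (x : SolidTori k) :
    IsSolidTorusParam (connectedComponent x) toProdCircle where
  smooth := contMDiff_toProdCircle
  injOn := by
    intro y hy z hz h
    rw [connectedComponent_eq] at hy hz
    exact SolidTori.ext (congrArg Prod.fst h) (congrArg Prod.snd h) (hy.trans hz.symm)
  immersion y _ := mfderiv_toProdCircle_injective y
  image_eq := by
    rw [connectedComponent_eq]
    ext ⟨z, w⟩
    constructor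
    · rintro ⟨y, -, hy⟩
      rw [← hy]
      exact ⟨y.1.2, mem_univ _⟩
    · rintro ⟨hz, -⟩
      exact ⟨mk ⟨z, hz⟩ w x.index, rfl, rfl⟩

/-- The action of a group on the solid tori by rotations and permutations of the components. -/
noncomputable abbrev rotationAction {K : Type*} [Group K] (a b : K → Fin k → Circle)
    (σ : K → Fin k → Fin k) (h_one : ∀ i, a 1 i = 1 ∧ b 1 i = 1 ∧ σ 1 i = i)
    (h_mul : ∀ g h i, a (g * h) i = a g (σ h i) * a h i ∧ b (g * h) i = b g (σ h i) * b h i ∧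
      σ (g * h) i = σ g (σ h i)) : MulAction K (SolidTori k) where
  smul g := rotate (a g) (b g) (σ g)
  one_smul x := by
    obtain ⟨h1, h2, h3⟩ := h_one x.index
    refine SolidTori.ext ?_ ?_ h3
    · change ((a 1 x.index : Circle) : ℂ) * x.disc = x.disc
      rw [h1, Circle.coe_one, one_mul]
    · change b 1 x.index * x.circle = x.circle
      rw [h2, one_mul]
  mul_smul g h x := by
    obtain ⟨h1, h2, h3⟩ := h_mul g h x.index
    refine SolidTori.ext ?_ ?_ h3
    · change ((a (g * h) x.index : Circle) : ℂ) * x.disc =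
        a g (σ h x.index) * (a h x.index * x.disc)
      rw [h1, Circle.coe_mul, mul_assoc]
    · change b (g * h) x.index * x.circle = b g (σ h x.index) * (b h x.index * x.circle)
      rw [h2, mul_assoc]

end SolidTori

/-! ### The base torus in angular coordinates -/

section TorusSurface

variable {S : Type*} [TopologicalSpace S] [ChartedSpace (EuclideanSpace ℝ (Fin 2)) S]
  (φ : S ≃ₘ^∞⟮𝓡 2, (𝓡 1).prod (𝓡 1)⟯ (Circle × Circle))

theorem contMDiff_torus_fst : ContMDiff (𝓡 2) 𝓘(ℝ, ℂ) ∞ fun s => ((φ s).1 : ℂ) :=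
  contMDiff_circle_coe.comp (contMDiff_fst.comp φ.contMDiff)

theorem contMDiff_torus_snd : ContMDiff (𝓡 2) 𝓘(ℝ, ℂ) ∞ fun s => ((φ s).2 : ℂ) :=
  contMDiff_circle_coe.comp (contMDiff_snd.comp φ.contMDiff)

/-- Vanishing angular derivatives make both circle-valued components have zero derivative, and the
differentials of `φ` and of the inclusion of the circle are injective. -/
theorem eq_zero_of_torus_angular_eq_zero (s : S) {v : TangentSpace (𝓡 2) s}
    (h₁ : angular (φ s).1 (mvfderiv (𝓡 2) (fun s => ((φ s).1 : ℂ)) s v) = 0)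
    (h₂ : angular (φ s).2 (mvfderiv (𝓡 2) (fun s => ((φ s).2 : ℂ)) s v) = 0) : v = 0 := by
  have hφ : Function.Injective (mfderiv (𝓡 2) ((𝓡 1).prod (𝓡 1)) φ s) :=
    (φ.isLocalDiffeomorph.mfderivToContinuousLinearEquiv (by simp) s).injective
  have hφd : MDifferentiableAt (𝓡 2) ((𝓡 1).prod (𝓡 1)) φ s :=
    φ.contMDiff.mdifferentiable (by simp) s
  have d₁ : mvfderiv (𝓡 2) (fun s => ((φ s).1 : ℂ)) s v = 0 := by
    rw [mvfderiv_eq_angular_mul (fun s => Circle.norm_coe (φ s).1)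
      ((contMDiff_torus_fst φ s).of_le (by norm_cast)), h₁]
    simp
  have d₂ : mvfderiv (𝓡 2) (fun s => ((φ s).2 : ℂ)) s v = 0 := by
    rw [mvfderiv_eq_angular_mul (fun s => Circle.norm_coe (φ s).2)
      ((contMDiff_torus_snd φ s).of_le (by norm_cast)), h₂]
    simp
  refine (injective_iff_map_eq_zero _).1 hφ v (Prod.ext ?_ ?_)
  · refine (injective_iff_map_eq_zero _).1 (mvfderiv_coe_circle_injective (φ s).1) _ ?_
    have h := mvfderiv_manifold_comp (g := fun p : Circle × Circle => (p.1 : ℂ)) (f := φ) (x := s)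
      ((contMDiff_circle_coe.comp contMDiff_fst).mdifferentiable (n := 1) one_ne_zero _) hφd v
    have h' := mvfderiv_manifold_comp (g := fun c : Circle => (c : ℂ))
      (f := fun p : Circle × Circle => p.1) (x := φ s)
      (contMDiff_circle_coe.mdifferentiable (n := 1) one_ne_zero _)
      (contMDiff_fst.mdifferentiable (n := 1) one_ne_zero _)
      (mfderiv (𝓡 2) ((𝓡 1).prod (𝓡 1)) φ s v)
    refine Eq.trans ?_ ((h'.symm.trans h.symm).trans d₁)
    rw [show (fun p : Circle × Circle => p.1) = Prod.fst from rfl, mfderiv_fst]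
    rfl
  · refine (injective_iff_map_eq_zero _).1 (mvfderiv_coe_circle_injective (φ s).2) _ ?_
    have h := mvfderiv_manifold_comp (g := fun p : Circle × Circle => (p.2 : ℂ)) (f := φ) (x := s)
      ((contMDiff_circle_coe.comp contMDiff_snd).mdifferentiable (n := 1) one_ne_zero _) hφd v
    have h' := mvfderiv_manifold_comp (g := fun c : Circle => (c : ℂ))
      (f := fun p : Circle × Circle => p.2) (x := φ s)
      (contMDiff_circle_coe.mdifferentiable (n := 1) one_ne_zero _)
      (contMDiff_snd.mdifferentiable (n := 1) one_ne_zero _)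
      (mfderiv (𝓡 2) ((𝓡 1).prod (𝓡 1)) φ s v)
    refine Eq.trans ?_ ((h'.symm.trans h.symm).trans d₂)
    rw [show (fun p : Circle × Circle => p.2) = Prod.snd from rfl, mfderiv_snd]
    rfl

/-- The angular derivatives of a pair of functions with values in the unit circle. -/
noncomputable def angularPair (z w : ℂ) : ℂ × ℂ →L[ℝ] EuclideanSpace ℝ (Fin 2) :=
  (((EuclideanSpace.equiv (Fin 2) ℝ).symm : (Fin 2 → ℝ) →L[ℝ] EuclideanSpace ℝ (Fin 2)).comp
    (ContinuousLinearMap.pi ![ContinuousLinearMap.fst ℝ ℝ ℝ, ContinuousLinearMap.snd ℝ ℝ ℝ])).comp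
    (((angular z).comp (ContinuousLinearMap.fst ℝ ℂ ℂ)).prod
      ((angular w).comp (ContinuousLinearMap.snd ℝ ℂ ℂ)))

/-- An orientation of a torus has a constant sign in the angular coordinates. -/
theorem exists_torus_positiveFrame_iff [IsManifold (𝓡 2) 1 S] (oS : ManifoldOrientation (𝓡 2) S) :
    ∃ ε : ℤˣ, ∀ (s : S) (v : Fin 2 → TangentSpace (𝓡 2) s), oS.PositiveFrame s v ↔
      0 < (((ε : ℤˣ) : ℤ) : ℝ) *
        (angular (φ s).1 (mvfderiv (𝓡 2) (fun s => ((φ s).1 : ℂ)) s (v 0)) *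
          angular (φ s).2 (mvfderiv (𝓡 2) (fun s => ((φ s).2 : ℂ)) s (v 1)) -
        angular (φ s).2 (mvfderiv (𝓡 2) (fun s => ((φ s).2 : ℂ)) s (v 0)) *
          angular (φ s).1 (mvfderiv (𝓡 2) (fun s => ((φ s).1 : ℂ)) s (v 1))) := by
  have : PreconnectedSpace S := φ.symm.surjective.denseRange.preconnectedSpace
    φ.symm.continuous
  have : Nonempty S := ⟨φ.symm 1⟩
  have hj : ContMDiff (𝓡 2) 𝓘(ℝ, ℂ × ℂ) 1 fun s => (((φ s).1 : ℂ), ((φ s).2 : ℂ)) :=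
    ((contMDiff_torus_fst φ).prodMk_space (contMDiff_torus_snd φ)).of_le (by norm_cast)
  have hA : Continuous fun s => angularPair (φ s).1 (φ s).2 := by
    have hφ : Continuous φ := φ.continuous
    refine continuous_const.clm_comp ?_
    have h1 : Continuous fun s => (angular (φ s).1).comp (ContinuousLinearMap.fst ℝ ℂ ℂ) :=
      (continuous_angular.comp (continuous_subtype_val.comp
        (continuous_fst.comp hφ))).clm_comp continuous_const
    have h2 : Continuous fun s => (angular (φ s).2).comp (ContinuousLinearMap.snd ℝ ℂ ℂ) :=
      (continuous_angular.comp (continuous_subtype_val.comp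
        (continuous_snd.comp hφ))).clm_comp continuous_const
    exact (ContinuousLinearMap.prodₗᵢ (𝕜 := ℝ) (E := ℂ × ℂ) (F := ℝ) (G := ℝ) ℝ).continuous.comp
      (h1.prodMk h2)
  have hd : ∀ s (v : TangentSpace (𝓡 2) s),
      mvfderiv (𝓡 2) (fun s => (((φ s).1 : ℂ), ((φ s).2 : ℂ))) s v =
      (mvfderiv (𝓡 2) (fun s => ((φ s).1 : ℂ)) s v,
        mvfderiv (𝓡 2) (fun s => ((φ s).2 : ℂ)) s v) := fun s v =>
    mvfderiv_prodMk ((contMDiff_torus_fst φ).mdifferentiable (by simp) s)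
      ((contMDiff_torus_snd φ).mdifferentiable (by simp) s) v
  have hdet : ∀ s, (inducedFrame (𝓡 2) (fun s => (((φ s).1 : ℂ), ((φ s).2 : ℂ)))
      (fun s => angularPair (φ s).1 (φ s).2) s).det ≠ 0 := by
    intro s
    refine det_ne_zero_of_injective ((injective_iff_map_eq_zero _).2 ?_)
    suffices h : ∀ v : TangentSpace (𝓡 2) s, angularPair (φ s).1 (φ s).2
        (mvfderiv (𝓡 2) (fun s => (((φ s).1 : ℂ), ((φ s).2 : ℂ))) s v) = 0 → v = 0 from h
    intro v hv
    rw [hd] at hv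
    exact eq_zero_of_torus_angular_eq_zero φ s
      (congrArg (fun y : EuclideanSpace ℝ (Fin 2) => y 0) hv)
      (congrArg (fun y : EuclideanSpace ℝ (Fin 2) => y 1) hv)
  obtain ⟨ε, hε⟩ := oS.exists_positiveFrame_iff hj hA hdet
  refine ⟨ε, fun s v => ?_⟩
  rw [hε, vecDet, Matrix.det_fin_two]
  simp only [inducedFrame_apply, hd]
  exact Iff.rfl

end TorusSurface

/-! ### From the smooth principal bundle to the covering of the torus -/

section PrincipalBundle

variable {G : Type*} [Group G] [TopologicalSpace G]
  {S : Type*} [TopologicalSpace S] [ChartedSpace (EuclideanSpace ℝ (Fin 2)) S]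
  {P : Type*} [TopologicalSpace P] [ChartedSpace (EuclideanSpace ℝ (Fin 2)) P]
  [MulAction Gᵐᵒᵖ P] {π : P → S}

theorem IsPrincipalBundle.nonempty [Nonempty S] (hπ : IsPrincipalBundle G π) : Nonempty P := by
  obtain ⟨s⟩ := ‹Nonempty S›
  obtain ⟨e, -, -⟩ := hπ.locally_trivial s
  exact ⟨e.toPartialEquiv.symm (s, 1)⟩

variable [DiscreteTopology G]

theorem IsPrincipalBundle.isCoveringMap (hπ : IsPrincipalBundle G π) : IsCoveringMap π := by
  choose e he using hπ.locally_trivial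
  exact IsCoveringMap.mk π (fun _ => G) e fun s => (he s).1

theorem IsPrincipalBundle.isTorusBundle (hπ : IsPrincipalBundle G π)
    (φ : S ≃ₘ^∞⟮𝓡 2, (𝓡 1).prod (𝓡 1)⟯ (Circle × Circle)) :
    IsTorusBundle G fun p => φ (π p) where
  isCoveringMap := hπ.isCoveringMap.homeomorph_comp φ.toHomeomorph
  continuous_smul g := (hπ.smooth_action g.unop).continuous
  map_smul g p := congrArg φ (hπ.proj_action g.unop p)
  free g p h := MulOpposite.unop_injective (hπ.free g.unop p h)
  transitive p q h := by
    obtain ⟨g, hg⟩ := hπ.transitive p q (φ.injective h)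
    exact ⟨_, hg⟩

/-- The lift of the loop around the first circle factor is an orbit of the flow. -/
theorem IsPrincipalBundle.hasMonodromy (hπ : IsPrincipalBundle G π)
    (φ : S ≃ₘ^∞⟮𝓡 2, (𝓡 1).prod (𝓡 1)⟯ (Circle × Circle)) {p : P} {g : G}
    (hg : MulOpposite.op g • (hπ.isTorusBundle φ).flow (1, 0) p = p) :
    HasMonodromy π (firstLoop φ (π p)) p g := by
  have hf := hπ.isTorusBundle φ
  refine ⟨⟨fun t => hf.flow ((t : ℝ), 0) p, (hf.continuous_flow p).comp
    (continuous_subtype_val.prodMk continuous_const)⟩, fun t => φ.injective ?_, ?_, ?_⟩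
  · change φ (π (hf.flow ((t : ℝ), 0) p)) = φ (φ.symm _)
    rw [φ.apply_symm_apply, hf.map_flow]
    simp [torusExp, Prod.ext_iff]
  · exact hf.flow_zero p
  · change hf.flow (((0 : unitInterval) : ℝ), 0) p =
      MulOpposite.op g • hf.flow (((1 : unitInterval) : ℝ), 0) p
    rw [Set.Icc.coe_zero, Set.Icc.coe_one, hg]
    exact hf.flow_zero p

end PrincipalBundle

/-! ### Linear changes of angles -/

section AngleChange

variable {E H X : Type*} [NormedAddCommGroup E] [NormedSpace ℝ E] [TopologicalSpace H]
  {I : ModelWithCorners ℝ E H} [TopologicalSpace X] [ChartedSpace H X]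

/-- Functions with values in the unit circle whose arguments are locally a linear combination of
those of two smooth functions. -/
theorem contMDiff_and_angular_of_localAngle {f₁ f₂ u : X → Circle}
    (h₁ : ContMDiff I 𝓘(ℝ, ℂ) ∞ fun x => (f₁ x : ℂ))
    (h₂ : ContMDiff I 𝓘(ℝ, ℂ) ∞ fun x => (f₂ x : ℂ)) (L : ℝ × ℝ →L[ℝ] ℝ)
    (hu : ∀ x, ∀ᶠ y in 𝓝 x, u y = u x * Circle.exp (L (localAngle (fun x => (f₁ x : ℂ)) x y,
      localAngle (fun x => (f₂ x : ℂ)) x y))) :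
    ContMDiff I 𝓘(ℝ, ℂ) ∞ (fun x => (u x : ℂ)) ∧ ∀ (x : X) (v : TangentSpace I x),
      angular (u x) (mvfderiv I (fun x => (u x : ℂ)) x v) =
        L (angular (f₁ x) (mvfderiv I (fun x => (f₁ x : ℂ)) x v),
          angular (f₂ x) (mvfderiv I (fun x => (f₂ x : ℂ)) x v)) := by
  have hslit : ∀ (f : X → Circle) (x : X), (f x : ℂ) / f x ∈ Complex.slitPlane := fun f x => by
    rw [div_self (f x).coe_ne_zero]
    exact Complex.one_mem_slitPlane
  have hl₁ := fun x => contMDiffAt_localAngle (h₁ x) (hslit f₁ x)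
  have hl₂ := fun x => contMDiffAt_localAngle (h₂ x) (hslit f₂ x)
  have hl := fun x => (hl₁ x).prodMk_space (hl₂ x)
  have hL : ∀ x, ContMDiffAt I 𝓘(ℝ, ℝ) ∞ (fun y => L (localAngle (fun x => (f₁ x : ℂ)) x y,
      localAngle (fun x => (f₂ x : ℂ)) x y)) x := fun x =>
    L.contDiff.contMDiff.contMDiffAt.comp x (hl x)
  have hu' : ∀ x, (fun y => (u y : ℂ)) =ᶠ[𝓝 x] fun y => (u x : ℂ) *
      Complex.exp ((L (localAngle (fun x => (f₁ x : ℂ)) x y,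
        localAngle (fun x => (f₂ x : ℂ)) x y) : ℝ) * Complex.I) := by
    intro x
    filter_upwards [hu x] with y hy
    rw [hy, Circle.coe_mul, Circle.coe_exp]
  refine ⟨fun x => ?_, fun x v => ?_⟩
  · have hexp : ContDiff ℝ ∞ fun t : ℝ => (u x : ℂ) * Complex.exp (t * Complex.I) :=
      contDiff_const.mul (Complex.contDiff_exp.comp
        (Complex.ofRealCLM.contDiff.mul contDiff_const))
    exact (hexp.contMDiff.contMDiffAt.comp x (hL x)).congr_of_eventuallyEq (hu' x)
  · rw [angular_mvfderiv (fun y => Circle.norm_coe (u y))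
      ((hL x).mdifferentiableAt (by simp)) (hu' x) v]
    have h := mvfderiv_normedSpace_comp (g := L) L.differentiableAt
      ((hl x).mdifferentiableAt (by simp)) v
    rw [L.fderiv, mvfderiv_prodMk ((hl₁ x).mdifferentiableAt (by simp))
      ((hl₂ x).mdifferentiableAt (by simp)), mvfderiv_localAngle (fun y => Circle.norm_coe (f₁ y))
      ((h₁ x).of_le (by norm_cast)), mvfderiv_localAngle (fun y => Circle.norm_coe (f₂ y))
      ((h₂ x).of_le (by norm_cast))] at h
    exact h

end AngleChange

/-! ### Assembly of the extension -/

theorem mainTheorem3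
    {G : Type*} [Group G] [Finite G] [TopologicalSpace G] [DiscreteTopology G]
    -- an oriented closed surface `S` of genus one
    {S : Type*} [TopologicalSpace S] [ChartedSpace (EuclideanSpace ℝ (Fin 2)) S]
    [IsManifold (𝓡 2) ∞ S] (oS : ManifoldOrientation (𝓡 2) S)
    (φ : S ≃ₘ^∞⟮𝓡 2, (𝓡 1).prod (𝓡 1)⟯ (Circle × Circle))
    -- a principal `G`-bundle `π : P → S`, whose total space has the lifted orientation
    {P : Type*} [TopologicalSpace P] [ChartedSpace (EuclideanSpace ℝ (Fin 2)) P]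
    [IsManifold (𝓡 2) ∞ P] (oP : ManifoldOrientation (𝓡 2) P) [MulAction Gᵐᵒᵖ P]
    (π : P → S) (hπ : IsPrincipalBundle G π) (hor : PreservesOrientation oP oS π) :
    ∃ (M : Type) (_ : TopologicalSpace M) (_ : ChartedSpace (EuclideanHalfSpace 3) M)
      (_ : IsManifold (𝓡∂ 3) ∞ M) (_ : MulAction Gᵐᵒᵖ M)
      (oM : ManifoldOrientation (𝓡∂ 3) M) (ι : P → M),
      IsExtension G oP oM ι ∧
      -- every component of `M` meets the boundary
      (∀ x : M, ∃ p : P, x ∈ connectedComponent (ι p)) ∧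
      -- and is a solid torus, on which its stabilizer acts by rotations
      ∀ p : P, ∃ (g : G) (F : M → ℂ × Circle),
        HasMonodromy π (firstLoop φ (π p)) p g ∧
        IsSolidTorusParam (connectedComponent (ι p)) F ∧
        (∀ x ∈ connectedComponent (ι p),
          MulOpposite.op g • x ∈ connectedComponent (ι p) ∧
          F (MulOpposite.op g • x) =
            ((Circle.exp (2 * Real.pi / orderOf g) : ℂ) * (F x).1, (F x).2)) ∧
        ∀ h : G, ι (MulOpposite.op h • p) ∈ connectedComponent (ι p) →
          ∃ a b : Circle, ∀ x ∈ connectedComponent (ι p),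
            F (MulOpposite.op h • x) = ((a : ℂ) * (F x).1, b * (F x).2) := by
  have : Nonempty S := ⟨φ.symm 1⟩
  have : Nonempty P := hπ.nonempty
  have hf := hπ.isTorusBundle φ
  obtain ⟨k, n, m, a, U, idx, base, hn, hm, hbase, hsurj, hinj, hequiv, hmono, hloc⟩ :=
    hf.exists_angular_coordinates
  have hn0 : (0 : ℝ) < n := by exact_mod_cast hn
  have hm0 : (0 : ℝ) < m := by exact_mod_cast hm
  have hπs : ContMDiff (𝓡 2) (𝓡 2) ∞ π := hπ.smooth_proj.contMDiff
  have hf₁ : ContMDiff (𝓡 2) 𝓘(ℝ, ℂ) ∞ fun p => ((φ (π p)).1 : ℂ) :=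
    (contMDiff_torus_fst φ).comp hπs
  have hf₂ : ContMDiff (𝓡 2) 𝓘(ℝ, ℂ) ∞ fun p => ((φ (π p)).2 : ℂ) :=
    (contMDiff_torus_snd φ).comp hπs
  -- the coordinates of `P` are smooth
  obtain ⟨hU₁, hU₁'⟩ := contMDiff_and_angular_of_localAngle (u := fun q => (U q).1) hf₁ hf₂
    ((1 / n : ℝ) • ((a / m : ℝ) • ContinuousLinearMap.snd ℝ ℝ ℝ - ContinuousLinearMap.fst ℝ ℝ ℝ))
    (fun p => by
      filter_upwards [hloc p] with q hq
      rw [hq.2.1]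
      congr 2
      simp
      ring)
  obtain ⟨hU₂, hU₂'⟩ := contMDiff_and_angular_of_localAngle (u := fun q => (U q).2) hf₁ hf₂
    ((1 / m : ℝ) • ContinuousLinearMap.snd ℝ ℝ ℝ)
    (fun p => by
      filter_upwards [hloc p] with q hq
      rw [hq.2.2]
      congr 2
      simp
      ring)
  -- the boundary map
  let ι : P → SolidTori k := fun q => SolidTori.mk
    ⟨(U q).1, mem_closedBall_zero_iff.2 (Circle.norm_coe _).le⟩ (U q).2 (idx q)
  have hι : ContMDiff (𝓡 2) (𝓡∂ 3) ∞ ι := by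
    refine SolidTori.contMDiff_of_toProd (SolidTori.continuous_mk
      (hU₁.continuous.subtype_mk _) (continuous_induced_rng.2 hU₂.continuous) ?_)
      (hU₁.prodMk_space hU₂)
    exact ((IsLocallyConstant.iff_eventually_eq idx).2
      fun p => (hloc p).mono fun q hq => hq.1).continuous
  -- the action
  let act : MulAction Gᵐᵒᵖ (SolidTori k) := SolidTori.rotationAction
    (fun h i => (U (h • base i)).1) (fun h i => (U (h • base i)).2) (fun h i => idx (h • base i))
    -- The cocycle identities are `hequiv` at the point `h • base i`.
    (fun i => by simp [hbase]) (fun g h i => by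
      obtain ⟨h1, h2⟩ := hequiv g (h • base i)
      rw [mul_smul]
      exact ⟨congrArg Prod.fst h1, congrArg Prod.snd h1, h2⟩)
  -- the orientation
  obtain ⟨ε, hε⟩ := exists_torus_positiveFrame_iff φ oS
  -- The sign is reversed because the change from the angles of `S` to those of `U` has negative
  -- determinant.
  obtain ⟨oM, hoM⟩ := SolidTori.exists_orientation (k := k) (-ε)
  -- the derivative of the projection in angular coordinates
  have hproj : ∀ (p : P) (v : TangentSpace (𝓡 2) p),
      mvfderiv (𝓡 2) (fun p => ((φ (π p)).1 : ℂ)) p v =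
        mvfderiv (𝓡 2) (fun s => ((φ s).1 : ℂ)) (π p) (mfderiv (𝓡 2) (𝓡 2) π p v) ∧
      mvfderiv (𝓡 2) (fun p => ((φ (π p)).2 : ℂ)) p v =
        mvfderiv (𝓡 2) (fun s => ((φ s).2 : ℂ)) (π p) (mfderiv (𝓡 2) (𝓡 2) π p v) := fun p v =>
    ⟨mvfderiv_manifold_comp (f := π) ((contMDiff_torus_fst φ).mdifferentiable (by simp) _)
      (hπs.mdifferentiable (by simp) _) v,
    mvfderiv_manifold_comp (f := π) ((contMDiff_torus_snd φ).mdifferentiable (by simp) _)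
      (hπs.mdifferentiable (by simp) _) v⟩
  have himm : ∀ p : P, Function.Injective (mfderiv (𝓡 2) (𝓡∂ 3) ι p) := by
    intro p
    refine (injective_iff_map_eq_zero _).2 fun v hv => ?_
    have h1 : mvfderiv (𝓡 2) (SolidTori.toProd ∘ ι) p v = 0 := by
      rw [mvfderiv_manifold_comp (SolidTori.contMDiff_toProd.mdifferentiable (by simp) _)
        (hι.mdifferentiable (by simp) _), hv, map_zero]
    have h2 : mvfderiv (𝓡 2) (SolidTori.toProd ∘ ι) p v =
        (mvfderiv (𝓡 2) (fun q => ((U q).1 : ℂ)) p v,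
          mvfderiv (𝓡 2) (fun q => ((U q).2 : ℂ)) p v) :=
      mvfderiv_prodMk (hU₁.mdifferentiable (by simp) p) (hU₂.mdifferentiable (by simp) p) v
    rw [h1, eq_comm, Prod.mk_eq_zero] at h2
    have h3 := hU₁' p v
    have h4 := hU₂' p v
    rw [h2.1, map_zero] at h3
    rw [h2.2, map_zero] at h4
    rw [(hproj p v).1, (hproj p v).2] at h3 h4
    simp only [smul_apply, sub_apply,
      ContinuousLinearMap.coe_fst', ContinuousLinearMap.coe_snd', smul_eq_mul] at h3 h4
    -- The change of angles is triangular: the second coordinate kills the second angular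
    -- derivative, and then the first coordinate kills the first.
    have h5 := (mul_eq_zero.1 h4.symm).resolve_left (by positivity)
    rw [h5, mul_zero, zero_sub] at h3
    have h6 := neg_eq_zero.1 ((mul_eq_zero.1 h3.symm).resolve_left (by positivity))
    have h7 := eq_zero_of_torus_angular_eq_zero φ (π p) h6 h5
    exact (injective_iff_map_eq_zero _).1
      (hπ.smooth_proj.mfderivToContinuousLinearEquiv (by simp) p).injective v h7
  have hpos : ∀ (p : P) (v : Fin 2 → TangentSpace (𝓡 2) p), oP.PositiveFrame p v →
      0 < (((-ε : ℤˣ) : ℤ) : ℝ) *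
        (angular (U p).1 (mvfderiv (𝓡 2) (fun q => ((U q).1 : ℂ)) p (v 0)) *
          angular (U p).2 (mvfderiv (𝓡 2) (fun q => ((U q).2 : ℂ)) p (v 1)) -
        angular (U p).2 (mvfderiv (𝓡 2) (fun q => ((U q).2 : ℂ)) p (v 0)) *
          angular (U p).1 (mvfderiv (𝓡 2) (fun q => ((U q).1 : ℂ)) p (v 1))) := by
    intro p v hv
    have h1 := (hε _ _).1 (hor p v hv)
    rw [hU₁' p (v 0), hU₁' p (v 1), hU₂' p (v 0), hU₂' p (v 1)]
    rw [(hproj p (v 0)).1, (hproj p (v 0)).2, (hproj p (v 1)).1, (hproj p (v 1)).2]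
    -- The terms with `a` cancel in the minor, leaving the factor `-1 / (n m)`; its sign is absorbed
    -- by `-ε`.
    refine (mul_pos (mul_pos (inv_pos.2 hn0) (inv_pos.2 hm0)) h1).trans_eq ?_
    simp only [smul_apply, sub_apply,
      ContinuousLinearMap.coe_fst', ContinuousLinearMap.coe_snd', smul_eq_mul, Units.val_neg,
      Int.cast_neg]
    ring
  refine ⟨SolidTori k, inferInstance, inferInstance, inferInstance, act, oM, ι, ?_, ?_, ?_⟩
  · exact {
      compact := inferInstance
      hausdorff := inferInstance
      smooth_action := fun g => SolidTori.contMDiff_rotate _ _ _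
      oriented_action := fun g => SolidTori.preservesOrientation_rotate _ _ _ hoM
      smooth := hι
      injective := fun p q h => hinj p q (Prod.ext
        (Circle.ext (congrArg SolidTori.disc h)) (congrArg SolidTori.circle h))
        (congrArg SolidTori.index h)
      immersion := himm
      range_eq := by
        ext x
        rw [SolidTori.mem_boundary_iff]
        constructor
        · rintro ⟨p, rfl⟩
          exact Circle.norm_coe _
        · intro hx
          obtain ⟨q, hq, hi⟩ := hsurj (⟨x.disc, mem_sphere_zero_iff_norm.2 hx⟩, x.circle) x.index
          refine ⟨q, SolidTori.ext ?_ ?_ hi⟩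
          · exact congrArg (fun c : Circle × Circle => (c.1 : ℂ)) hq
          · exact congrArg Prod.snd hq
      oriented_boundary := SolidTori.isOrientedBoundaryMap hoM oP hι (u₁ := fun q => (U q).1)
        (u₂ := fun q => (U q).2) (fun _ => rfl) (fun _ => rfl) hpos
      equivariant := fun g p => by
        obtain ⟨h1, h2⟩ := hequiv (MulOpposite.op g) p
        refine SolidTori.ext ?_ ?_ h2
        · exact congrArg (fun c : Circle × Circle => (c.1 : ℂ)) h1
        · exact congrArg Prod.snd h1 }
  · intro x
    refine ⟨base x.index, ?_⟩
    rw [SolidTori.connectedComponent_eq]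
    exact (hbase x.index).2.symm
  · intro p
    obtain ⟨g, hg, hgn, hgU⟩ := hmono p
    refine ⟨g, SolidTori.toProdCircle, hπ.hasMonodromy φ hg, SolidTori.isSolidTorusParam _, ?_, ?_⟩
    · intro x hx
      rw [SolidTori.connectedComponent_eq] at hx ⊢
      have hx' : x.index = idx p := hx
      -- The action on the solid torus is defined by the image of its base point, where `U` is `1`;
      -- so the rotation of the boundary determines the rotation factors.
      obtain ⟨h1, h2⟩ := hgU (base x.index) ((hbase x.index).2.trans hx')
      rw [(hbase x.index).1, mul_one] at h1
      rw [(hbase x.index).2] at h2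
      refine ⟨h2.trans hx', Prod.ext ?_ ?_⟩
      · rw [hgn]
        exact congrArg (fun c : Circle × Circle => (c.1 : ℂ) * x.disc) h1
      · exact (congrArg (fun c : Circle × Circle => c.2 * x.circle) h1).trans (one_mul _)
    · intro h _
      refine ⟨(U (MulOpposite.op h • base (idx p))).1, (U (MulOpposite.op h • base (idx p))).2,
        fun x hx => ?_⟩
      rw [SolidTori.connectedComponent_eq] at hx
      have hx' : x.index = idx p := hx
      rw [← hx']
      rfl
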